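/- A polygon is given by its vertices $v_0,\dots,v_{n-1}\in\mathbb{R}^2$, $n\ge 3$, in boundary order (either orientation, any starting vertex). It is simple if consecutive vertices are distinct, consecutive edges meet exactly in their common vertex, and non-consecutive edges are disjoint; it is orthogonal if horizontal and vertical edges alternate along its boundary; it is $x$-monotone if its boundary splits into two chains such that the $x$-coordinate is nondecreasing along one and nonincreasing along the other. The polygon is identified with the closed region $P$ that it bounds: the boundary and the points lying in a bounded component of the complement of the boundary. Two points $p,q\in P$ are orthogonally visible (r-visible) to each other if the closed axis-parallel (possibly degenerate) rectangle spanned by $p$ and $q$ is contained in $P$. A guard set of $P$ is a finite set $G\subset P$, whose points may lie anywhere in $P$, such that every point of $P$ is orthogonally visible from some point of $G$. As a model for purely geometric algorithms, consider deterministic random access machine programs with finitely many integer registers, integer arrays and real arrays, and with assignments, sequencing, branching and while-loops, each assignment and each test costing one step. The only operations on integers (which serve as array indices) are copying, incrementing, decrementing and comparing; the only operations on reals (coordinates) are copying and comparing. **Theorem.** There are one such program and one constant $C$ with the following property. For every $n$ and every simple, orthogonal, $x$-monotone polygon $P$ with $n$ vertices, the program, started with $n$ and the coordinates of the vertices in boundary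 order, halts after at most $Cn$ steps and outputs a number $k$ together with $k$ distinct points, such that these $k$ points form a guard set of $P$ of minimum cardinality. That is, the minimum number of point guards under orthogonal visibility, and positions for them, are computed in $O(n)$ time by a purely geometric algorithm. -/

import Mathlib

/-! ## Orthogonal x-monotone polygons and orthogonal guards -/

namespace ArtGallery

/-- A simple closed polygon: at least three vertices, consecutive vertices distinct, consecutive
edges meet exactly in their common vertex, and non-consecutive edges are disjoint. -/
def IsSimple {n : ℕ} (P : Polygon (ℝ × ℝ) n) : Prop :=
  3 ≤ n ∧ P.HasNondegenerateEdges ∧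
  (∀ i : Fin n,
    P.edgeSet ℝ i ∩ P.edgeSet ℝ (finRotate n i) = {P (finRotate n i)}) ∧
  (∀ i j : Fin n, i ≠ j → j ≠ finRotate n i → i ≠ finRotate n j →
    Disjoint (P.edgeSet ℝ i) (P.edgeSet ℝ j))

/-- The edge from vertex `i` to the next vertex is horizontal. -/
def IsHorizontalEdge {n : ℕ} (P : Polygon (ℝ × ℝ) n) (i : Fin n) : Prop :=
  (P i).2 = (P (finRotate n i)).2

/-- The edge from vertex `i` to the next vertex is vertical. -/
def IsVerticalEdge {n : ℕ} (P : Polygon (ℝ × ℝ) n) (i : Fin n) : Prop :=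
  (P i).1 = (P (finRotate n i)).1

/-- Orthogonal polygon: along the boundary horizontal and vertical edges alternate, so that every
vertex is a genuine corner. -/
def IsOrthogonal {n : ℕ} (P : Polygon (ℝ × ℝ) n) : Prop :=
  ∀ i : Fin n,
    (IsHorizontalEdge P i ∧ IsVerticalEdge P (finRotate n i)) ∨
    (IsVerticalEdge P i ∧ IsHorizontalEdge P (finRotate n i))

/-- `x`-monotone polygon: the boundary cycle splits into two chains, along the first of which the
`x`-coordinate is nondecreasing while along the second it is nonincreasing. -/
def IsXMonotone {n : ℕ} (P : Polygon (ℝ × ℝ) n) : Prop :=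
  ∃ (s : Fin n) (k : ℕ), k ≤ n ∧
    (∀ i : ℕ, i < k → (P ((finRotate n)^[i] s)).1 ≤ (P ((finRotate n)^[i + 1] s)).1) ∧
    (∀ i : ℕ, k ≤ i → i < n → (P ((finRotate n)^[i + 1] s)).1 ≤ (P ((finRotate n)^[i] s)).1)

/-- The closed region bounded by the polygon: the boundary together with all points that lie in a
bounded connected component of the complement of the boundary. -/
def region {n : ℕ} (P : Polygon (ℝ × ℝ) n) : Set (ℝ × ℝ) :=
  P.boundary ℝ ∪
    {p | p ∉ P.boundary ℝ ∧ Bornology.IsBounded (connectedComponentIn (P.boundary ℝ)ᶜ p)}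

/-- Orthogonal visibility (r-visibility) in a region `R`: the axis-parallel rectangle spanned by
the two points is contained in `R`. (`Set.uIcc p q` in `ℝ × ℝ` is that closed rectangle.) -/
def OrthVisible (R : Set (ℝ × ℝ)) (p q : ℝ × ℝ) : Prop :=
  Set.uIcc p q ⊆ R

/-- A finite set of points of `R` such that every point of `R` is orthogonally visible from one of
them. -/
def IsGuardSet (R : Set (ℝ × ℝ)) (G : Finset (ℝ × ℝ)) : Prop :=
  (∀ g ∈ G, g ∈ R) ∧ ∀ p ∈ R, ∃ g ∈ G, OrthVisible R g p

/-- A guard set of minimum cardinality; the guards may be anywhere in `R`. -/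
def IsMinimumGuardSet (R : Set (ℝ × ℝ)) (G : Finset (ℝ × ℝ)) : Prop :=
  IsGuardSet R G ∧ ∀ H : Finset (ℝ × ℝ), IsGuardSet R H → G.card ≤ H.card

end ArtGallery

/-! ## The machine model

A random access machine with unit-cost steps, with integer registers for counting and for
addressing, and real memory for coordinates. Coordinates can only be copied and compared; in
particular there is no rounding. Integers can only be incremented, decremented and compared.
A program is a finite object that mentions finitely many registers and arrays. -/

namespace GeomRAM

/-- Memory: integer registers, integer arrays, and arrays of reals, each identified by a number. -/
structure State where
  ivar : ℕ → ℕ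
  iarr : ℕ → ℕ → ℕ
  rarr : ℕ → ℕ → ℝ

/-- Integer expressions. -/
inductive IExpr where
  | const (k : ℕ)
  | var (v : ℕ)
  | get (a : ℕ) (i : IExpr)
  | succ (e : IExpr)
  | pred (e : IExpr)

/-- Value of an integer expression (`pred 0 = 0`). -/
def IExpr.eval (s : State) : IExpr → ℕ
  | const k => k
  | var v => s.ivar v
  | get a i => s.iarr a (i.eval s)
  | succ e => e.eval s + 1
  | pred e => e.eval s - 1

/-- Tests: comparisons of integers, comparisons of stored reals, and Boolean combinations. -/
inductive Cond where
  | ieq (e f : IExpr)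
  | ilt (e f : IExpr)
  | rlt (a : ℕ) (i : IExpr) (b : ℕ) (j : IExpr)
  | not (c : Cond)
  | and (c d : Cond)

/-- The test succeeds; `rlt a i b j` tests `a[i] < b[j]` for real arrays `a` and `b`. -/
def Cond.Holds (s : State) : Cond → Prop
  | ieq e f => e.eval s = f.eval s
  | ilt e f => e.eval s < f.eval s
  | rlt a i b j => s.rarr a (i.eval s) < s.rarr b (j.eval s)
  | not c => ¬ c.Holds s
  | and c d => c.Holds s ∧ d.Holds s

/-- Programs. `rcopy a i b j` is the assignment `a[i] := b[j]` between real arrays. -/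
inductive Prog where
  | skip
  | setVar (v : ℕ) (e : IExpr)
  | setArr (a : ℕ) (i e : IExpr)
  | rcopy (a : ℕ) (i : IExpr) (b : ℕ) (j : IExpr)
  | seq (p q : Prog)
  | ite (c : Cond) (p q : Prog)
  | loop (c : Cond) (p : Prog)

/-- Assignment to an integer register. -/
def State.setVar (s : State) (v x : ℕ) : State :=
  { s with ivar := Function.update s.ivar v x }

/-- Assignment to a cell of an integer array. -/
def State.setArr (s : State) (a i x : ℕ) : State :=
  { s with iarr := Function.update s.iarr a (Function.update (s.iarr a) i x) }

/-- Assignment to a cell of a real array. -/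
def State.setReal (s : State) (a i : ℕ) (x : ℝ) : State :=
  { s with rarr := Function.update s.rarr a (Function.update (s.rarr a) i x) }

/-- `Exec p s s' t`: started in `s`, the program `p` halts in state `s'` after `t` steps. Every
executed assignment and every evaluation of the test of a branch or of a loop is one step; it
performs a number of elementary operations that is bounded by the length of the program text.
`loop c p` repeats `p` as long as `c` holds. -/
inductive Exec : Prog → State → State → ℕ → Prop where
  | skip (s : State) : Exec Prog.skip s s 1
  | setVar (s : State) (v : ℕ) (e : IExpr) :
      Exec (Prog.setVar v e) s (s.setVar v (e.eval s)) 1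
  | setArr (s : State) (a : ℕ) (i e : IExpr) :
      Exec (Prog.setArr a i e) s (s.setArr a (i.eval s) (e.eval s)) 1
  | rcopy (s : State) (a : ℕ) (i : IExpr) (b : ℕ) (j : IExpr) :
      Exec (Prog.rcopy a i b j) s (s.setReal a (i.eval s) (s.rarr b (j.eval s))) 1
  | seq {p q : Prog} {s s' s'' : State} {t t' : ℕ} :
      Exec p s s' t → Exec q s' s'' t' → Exec (Prog.seq p q) s s'' (t + t')
  | iteTrue {c : Cond} {p q : Prog} {s s' : State} {t : ℕ} :
      c.Holds s → Exec p s s' t → Exec (Prog.ite c p q) s s' (t + 1)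
  | iteFalse {c : Cond} {p q : Prog} {s s' : State} {t : ℕ} :
      ¬ c.Holds s → Exec q s s' t → Exec (Prog.ite c p q) s s' (t + 1)
  | loopTrue {c : Cond} {p : Prog} {s s' s'' : State} {t t' : ℕ} :
      c.Holds s → Exec p s s' t → Exec (Prog.loop c p) s' s'' t' →
      Exec (Prog.loop c p) s s'' (t + t' + 1)
  | loopFalse {c : Cond} {p : Prog} {s : State} :
      ¬ c.Holds s → Exec (Prog.loop c p) s s 1

/-- The machine is deterministic: final state and number of steps are determined. -/
theorem Exec.deterministic {p : Prog} {s s₁ s₂ : State} {t₁ t₂ : ℕ}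
    (h₁ : Exec p s s₁ t₁) (h₂ : Exec p s s₂ t₂) : s₁ = s₂ ∧ t₁ = t₂ := by
  induction h₁ generalizing s₂ t₂ with
  | skip => cases h₂; exact ⟨rfl, rfl⟩
  | setVar => cases h₂; exact ⟨rfl, rfl⟩
  | setArr => cases h₂; exact ⟨rfl, rfl⟩
  | rcopy => cases h₂; exact ⟨rfl, rfl⟩
  | seq _ _ ih ih' =>
    cases h₂ with
    | seq a b =>
      obtain ⟨rfl, rfl⟩ := ih a
      obtain ⟨rfl, rfl⟩ := ih' b
      exact ⟨rfl, rfl⟩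
  | iteTrue hc _ ih =>
    cases h₂ with
    | iteTrue _ a => obtain ⟨rfl, rfl⟩ := ih a; exact ⟨rfl, rfl⟩
    | iteFalse hn _ => exact absurd hc hn
  | iteFalse hc _ ih =>
    cases h₂ with
    | iteTrue hp _ => exact absurd hp hc
    | iteFalse _ a => obtain ⟨rfl, rfl⟩ := ih a; exact ⟨rfl, rfl⟩
  | loopTrue hc _ _ ih ih' =>
    cases h₂ with
    | loopTrue _ a b =>
      obtain ⟨rfl, rfl⟩ := ih a
      obtain ⟨rfl, rfl⟩ := ih' b
      exact ⟨rfl, rfl⟩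
    | loopFalse hn => exact absurd hc hn
  | loopFalse hc =>
    cases h₂ with
    | loopTrue hp _ _ => exact absurd hp hc
    | loopFalse _ => exact ⟨rfl, rfl⟩

/-- Input: integer register `0` holds the number of vertices, real arrays `0` and `1` hold the
`x`- and `y`-coordinates of the vertices in boundary order; everything else is `0`. -/
noncomputable def input {n : ℕ} (P : Polygon (ℝ × ℝ) n) : State where
  ivar v := if v = 0 then n else 0
  iarr _ _ := 0
  rarr a i :=
    if h : i < n then
      if a = 0 then (P ⟨i, h⟩).1 else if a = 1 then (P ⟨i, h⟩).2 else 0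
    else 0

/-- Output, first part: a number, in integer register `0`. -/
def outputCount (s : State) : ℕ := s.ivar 0

/-- Output, second part: as many points as that number says, with their `x`-coordinates in real
array `2` and their `y`-coordinates in real array `3`. -/
noncomputable def outputPoints (s : State) : Finset (ℝ × ℝ) :=
  (Finset.range (outputCount s)).image fun i => (s.rarr 2 i, s.rarr 3 i)

end GeomRAM

/-!
# Optimal orthogonal guards of monotone orthogonal polygons in linear time

Merging the breakpoints of the two `x`-monotone chains cuts the polygon into a left-to-right
sequence of slabs, rectangles `[x k, x (k + 1)] × [l k, u k]` of which consecutive ones share a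
vertical segment of positive length. That the region, defined through bounded components of the
complement of the boundary, is the union of the slabs needs no Jordan curve theorem: the union is
closed, the boundary contains its frontier, so components that start inside stay inside; and its
vertical sections are intervals, so that a vertical ray leads from each outer point to infinity
(`bounded_components_eq`, `IsMerge.region_eq`, `region_eq_slabs`).

For slabs, a guard and a point see each other if and only if both levels lie in the vertical extent
of all slabs between them. A guard may therefore be assumed to stand on a breakpoint, and its level
matters only through the range of slabs that contain it. The greedy sweep keeps the points that the
guards placed so far do not see, and places the next guard as late as possible: at the last
breakpoint up to which the level of every unseen point is clear. This guard has to serve all slabs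
since the first one with an unseen point, and its level is chosen so that it serves as many further
slabs as possible; the level is found during the following steps, as the lower end of the running
intersection of the vertical extents for as long as it is nonempty. For each slab, it suffices to
know this intersection, the levels visible from the last guard, and the hull of the levels of unseen
points, so that a slab takes constant time (`Sweep.step`).

Optimality is shown by duality (`LowerBound.step`). When a guard is placed at the left end of slab
`k`, there is an unseen point whose level is blocked at slab `k`, and an unseen point in the first
slab that has to be served. A point that is still unseen after this either is blocked on the way
from slab `k`, and then shares no guard with the former point, or no level is common to the slabs up
to it, and then it shares no guard with the latter. Hence every guard set has one guard for each of
the guards placed by the sweep (`Slabs.sweepGuards_spec`).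

The program stores the coordinates three times in a row, finds the leftmost vertical edge, which is
the only place where the boundary turns back from left to right, walks from there along both chains
to compute the slabs, and runs the sweep. Loop-free program parts are treated through their effect
`Prog.den` and the bound `Prog.cost`, and loops through `reach_loop`.
-/

namespace ArtGallery

open Set

/-! ### Slabs and lines of sight -/

/-- Every abscissa between two breakpoints lies in one of the slabs between them. -/
lemma exists_slab_of_mem {x : ℕ → ℝ} {i j : ℕ} (hij : i < j) {z : ℝ}
    (h1 : x i ≤ z) (h2 : z ≤ x j) :
    ∃ k, i ≤ k ∧ k < j ∧ x k ≤ z ∧ z ≤ x (k + 1) := by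
  induction j, hij using Nat.le_induction with
  | base => exact ⟨i, le_rfl, Nat.lt_succ_self i, h1, h2⟩
  | succ j hij ih =>
    by_cases h : z ≤ x j
    · obtain ⟨k, a, b, c⟩ := ih h
      exact ⟨k, a, b.trans (Nat.lt_succ_self j), c⟩
    · exact ⟨j, by omega, by omega, (not_le.1 h).le, h2⟩

/-- A sequence of `m` vertical slabs: slab `k` is the rectangle
`[x k, x (k + 1)] × [l k, u k]`. -/
structure Slabs where
  m : ℕ
  x : ℕ → ℝ
  l : ℕ → ℝ
  u : ℕ → ℝ

namespace Slabs

/-- The slabs have positive width and positive height. -/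
structure Valid (S : Slabs) : Prop where
  pos : 0 < S.m
  x_lt : ∀ k < S.m, S.x k < S.x (k + 1)
  l_lt : ∀ k < S.m, S.l k < S.u k

/-- The union of the slabs. -/
def region (S : Slabs) : Set (ℝ × ℝ) :=
  {p | ∃ k < S.m, (S.x k ≤ p.1 ∧ p.1 ≤ S.x (k + 1)) ∧ S.l k ≤ p.2 ∧ p.2 ≤ S.u k}

/-- The level `y` lies in the vertical extent of every slab `j` with `a ≤ j < b`. -/
def Clear (S : Slabs) (y : ℝ) (a b : ℕ) : Prop :=
  ∀ j, a ≤ j → j < b → S.l j ≤ y ∧ y ≤ S.u j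

/-- The point at height `y` in the middle of slab `a`. -/
noncomputable def mid (S : Slabs) (a : ℕ) (y : ℝ) : ℝ × ℝ :=
  ((S.x a + S.x (a + 1)) / 2, y)

/-- The guard `g` sees every point at height `y` of slab `a`. -/
def SeesRow (S : Slabs) (g : ℝ × ℝ) (a : ℕ) (y : ℝ) : Prop :=
  ∀ z, S.x a ≤ z → z ≤ S.x (a + 1) → OrthVisible S.region g (z, y)

variable {S : Slabs}

lemma Clear.mono {y : ℝ} {a b a' b' : ℕ} (h : S.Clear y a b) (ha : a ≤ a') (hb : b' ≤ b) :
    S.Clear y a' b' :=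
  fun j h1 h2 => h j (ha.trans h1) (h2.trans_le hb)

lemma clear_succ {y : ℝ} {a b : ℕ} (hab : a ≤ b) :
    S.Clear y a (b + 1) ↔ S.Clear y a b ∧ S.l b ≤ y ∧ y ≤ S.u b := by
  constructor
  · exact fun h => ⟨h.mono le_rfl (Nat.le_succ b), h b hab (Nat.lt_succ_self b)⟩
  · rintro ⟨h, h'⟩ j h1 h2
    rcases Nat.lt_succ_iff_lt_or_eq.1 h2 with h3 | rfl
    exacts [h j h1 h3, h']

/-- Two points between breakpoints `i` and `j` see each other if both levels are clear there. -/
lemma visible_of_clear {i j : ℕ} (hij : i < j) (hj : j ≤ S.m) {g p : ℝ × ℝ}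
    (hg1 : S.x i ≤ g.1) (hg2 : g.1 ≤ S.x j) (hp1 : S.x i ≤ p.1) (hp2 : p.1 ≤ S.x j)
    (hg : S.Clear g.2 i j) (hp : S.Clear p.2 i j) : OrthVisible S.region g p := by
  rintro ⟨z, w⟩ hz
  rw [← uIcc_prod_uIcc] at hz
  obtain ⟨hz, hw⟩ := hz
  simp only [uIcc, mem_Icc, inf_le_iff, le_sup_iff] at hz hw
  obtain ⟨k, a, b, c⟩ := exists_slab_of_mem (x := S.x) (z := z) hij
    (by rcases hz.1 with h | h <;> linarith) (by rcases hz.2 with h | h <;> linarith)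
  have h1 := hg k a b
  have h2 := hp k a b
  exact ⟨k, by omega, c, by rcases hw.1 with h | h <;> linarith,
    by rcases hw.2 with h | h <;> linarith⟩

namespace Valid

variable (hS : S.Valid)
include hS

lemma x_lt_of_lt {i j : ℕ} (hij : i < j) (hj : j ≤ S.m) : S.x i < S.x j := by
  induction j, hij using Nat.le_induction with
  | base => exact hS.x_lt i (by omega)
  | succ j hij ih => exact (ih (by omega)).trans (hS.x_lt j (by omega))

lemma x_le_of_le {i j : ℕ} (hij : i ≤ j) (hj : j ≤ S.m) : S.x i ≤ S.x j := by
  rcases hij.eq_or_lt with rfl | h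
  exacts [le_rfl, (hS.x_lt_of_lt h hj).le]

lemma slab_unique {j k : ℕ} (hj : j < S.m) (hk : k < S.m) {z : ℝ}
    (h1 : S.x k < z) (h2 : z < S.x (k + 1)) (h3 : S.x j ≤ z) (h4 : z ≤ S.x (j + 1)) : j = k := by
  rcases lt_trichotomy j k with h | h | h
  · have := hS.x_le_of_le (show j + 1 ≤ k from h) hk.le
    linarith
  · exact h
  · have := hS.x_le_of_le (show k + 1 ≤ j from h) hj.le
    linarith

/-- A line of sight meets the interior of each slab that it crosses at levels inside that slab. -/
lemma levels_of_visible {g p : ℝ × ℝ} (h : OrthVisible S.region g p) {k : ℕ} (hk : k < S.m)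
    {z : ℝ} (h1 : S.x k < z) (h2 : z < S.x (k + 1)) (hz : z ∈ uIcc g.1 p.1) :
    (S.l k ≤ g.2 ∧ g.2 ≤ S.u k) ∧ (S.l k ≤ p.2 ∧ p.2 ≤ S.u k) := by
  have key : ∀ w ∈ uIcc g.2 p.2, S.l k ≤ w ∧ w ≤ S.u k := by
    intro w hw
    have : (z, w) ∈ uIcc g p := by rw [← uIcc_prod_uIcc]; exact ⟨hz, hw⟩
    obtain ⟨j, hj, h3, h4⟩ := h this
    obtain rfl := hS.slab_unique hj hk h1 h2 h3.1 h3.2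
    exact h4
  exact ⟨key _ left_mem_uIcc, key _ right_mem_uIcc⟩

lemma mid_mem {a : ℕ} (ha : a < S.m) : S.x a < (S.mid a 0).1 ∧ (S.mid a 0).1 < S.x (a + 1) := by
  have := hS.x_lt a ha
  constructor <;> simp only [mid] <;> linarith

lemma mid_le {a b : ℕ} (hab : a ≤ b) (hb : b < S.m) : (S.mid a 0).1 ≤ (S.mid b 0).1 := by
  have h1 := hS.x_le_of_le hab hb.le
  have h2 := hS.x_le_of_le (Nat.succ_le_succ hab) hb
  simp only [mid, Nat.succ_eq_add_one] at *
  linarith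

/-- A guard that sees a point of slab `a` and a point of slab `b` stands at a level that is clear
from slab `a` to slab `b`, wherever it stands. -/
lemma clear_of_visible_two {g : ℝ × ℝ} {a b : ℕ} {y z : ℝ} (hb : b < S.m)
    (h1 : OrthVisible S.region g (S.mid a y)) (h2 : OrthVisible S.region g (S.mid b z)) :
    S.Clear g.2 a (b + 1) := by
  intro k hk hk'
  have hkm : k < S.m := by omega
  have m1 := hS.mid_mem hkm
  have m2 := hS.mid_le hk hkm
  have m3 := hS.mid_le (Nat.lt_succ_iff.1 hk') hb
  rcases le_total g.1 (S.mid k 0).1 with h | h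
  · exact (hS.levels_of_visible h2 hkm m1.1 m1.2 (mem_uIcc.2 (Or.inl ⟨h, m3⟩))).1
  · exact (hS.levels_of_visible h1 hkm m1.1 m1.2 (mem_uIcc.2 (Or.inr ⟨m2, h⟩))).1

/-- A guard of a point that is blocked at a later slab `d` stands left of that slab. -/
lemma le_of_visible_of_blocked {g : ℝ × ℝ} {a d : ℕ} {y : ℝ} (had : a < d) (hd : d < S.m)
    (h : OrthVisible S.region g (S.mid a y)) (hy : ¬(S.l d ≤ y ∧ y ≤ S.u d)) : g.1 ≤ S.x d := by
  by_contra! hg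
  have hx := hS.x_lt d hd
  obtain ⟨z, hz1, hz2⟩ := exists_between (lt_min hx hg)
  have m1 := (hS.mid_mem (had.trans hd)).2
  have m2 := hS.x_le_of_le (show a + 1 ≤ d from had) hd.le
  rw [lt_min_iff] at hz2
  refine hy (hS.levels_of_visible h hd hz1 hz2.1 (mem_uIcc.2 (Or.inr ⟨?_, hz2.2.le⟩))).2
  change (S.mid a 0).1 ≤ z
  linarith

/-- A guard of a point that is blocked at an earlier slab `d` stands right of the left ends of all
slabs up to `d`. -/
lemma lt_of_visible_of_blocked {g : ℝ × ℝ} {b d e : ℕ} {y : ℝ} (hed : e ≤ d) (hdb : d ≤ b)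
    (hb : b < S.m) (h : OrthVisible S.region g (S.mid b y))
    (hy : ¬(S.l d ≤ y ∧ y ≤ S.u d)) : S.x e < g.1 := by
  by_contra! hg
  have hdm : d < S.m := by omega
  have m1 := hS.mid_mem hdm
  have m2 := hS.x_le_of_le hed hdm.le
  exact hy (hS.levels_of_visible h hdm m1.1 m1.2
    (mem_uIcc.2 (Or.inl ⟨by linarith, hS.mid_le hdb hb⟩))).2

lemma clear_of_visible_of_le {g : ℝ × ℝ} {b d : ℕ} {y : ℝ} (hb : b < S.m) (hg : g.1 ≤ S.x d)
    (h : OrthVisible S.region g (S.mid b y)) : S.Clear g.2 d (b + 1) := by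
  intro k hk hk'
  have hkm : k < S.m := by omega
  have m1 := hS.mid_mem hkm
  have m2 := hS.x_le_of_le hk hkm.le
  exact (hS.levels_of_visible h hkm m1.1 m1.2
    (mem_uIcc.2 (Or.inl ⟨by linarith, hS.mid_le (Nat.lt_succ_iff.1 hk') hb⟩))).1

lemma mid_mem_region {a : ℕ} {y : ℝ} (ha : a < S.m) (hy : S.l a ≤ y ∧ y ≤ S.u a) :
    S.mid a y ∈ S.region :=
  ⟨a, ha, ⟨(hS.mid_mem ha).1.le, (hS.mid_mem ha).2.le⟩, hy⟩

lemma seesRow_left {d a : ℕ} {g y : ℝ} (had : a < d) (hd : d ≤ S.m)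
    (hg : S.Clear g a d) (hy : S.Clear y a d) : S.SeesRow (S.x d, g) a y := by
  intro z h1 h2
  have h3 := hS.x_le_of_le (show a + 1 ≤ d from had) hd
  exact visible_of_clear had hd (hS.x_le_of_le had.le hd) le_rfl h1 (h2.trans h3) hg hy

lemma seesRow_right {d a : ℕ} {g y : ℝ} (hda : d ≤ a) (ha : a < S.m)
    (hg : S.Clear g d (a + 1)) (hy : S.Clear y d (a + 1)) : S.SeesRow (S.x d, g) a y := by
  intro z h1 h2
  exact visible_of_clear (Nat.lt_succ_of_le hda) ha le_rfl
    (hS.x_le_of_le (by omega) ha) ((hS.x_le_of_le hda ha.le).trans h1) h2 hg hy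

end Valid

end Slabs

/-! ### A lower bound for the number of guards -/

namespace Slabs

/-- Relative to a last guard at the left end of slab `e` that has slabs `i', …, a` to serve, the
point at height `y` of slab `a ≥ e` is not seen: its level is blocked on the way from slab `e`,
or no guard can serve slabs `i'` to `a`. (If `c = 0`, there is no last guard.) -/
def Unseen (S : Slabs) (c e i' a : ℕ) (y : ℝ) : Prop :=
  e ≤ a ∧ (S.l a ≤ y ∧ y ≤ S.u a) ∧
    (¬S.Clear y e (a + 1) ∨ c = 0 ∨ ∀ z, ¬S.Clear z i' (a + 1))

/-- A point at height `y` of slab `a' ≥ a` that is hidden, either by its own level or for every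
level of the guard, from all guards up to the left end of slab `e`. -/
def Hidden (S : Slabs) (e a a' : ℕ) (y : ℝ) : Prop :=
  a ≤ a' ∧ e ≤ a' ∧ (¬S.Clear y e (a' + 1) ∨ ∀ z, ¬S.Clear z e (a' + 1))

/-- Every guard set has `c` guards, and next to any unseen point it has `c` guards that see neither
this point nor any point that remains hidden later on. -/
def LowerBound (S : Slabs) (c e i' : ℕ) : Prop :=
  ∀ H : Finset (ℝ × ℝ), IsGuardSet S.region H → c ≤ H.card ∧
    ∀ a y, a < S.m → S.Unseen c e i' a y → ∃ B ⊆ H, B.card = c ∧ ∀ g ∈ B,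
      ¬OrthVisible S.region g (S.mid a y) ∧
      ∀ a' y', a' < S.m → S.Hidden e a a' y' → ¬OrthVisible S.region g (S.mid a' y')

variable {S : Slabs}

lemma not_clear_iff {y : ℝ} {a b : ℕ} :
    ¬S.Clear y a b ↔ ∃ j, a ≤ j ∧ j < b ∧ ¬(S.l j ≤ y ∧ y ≤ S.u j) := by
  simp only [Clear, not_forall, exists_prop]

lemma lowerBound_zero (i' : ℕ) : S.LowerBound 0 0 i' := by
  intro H _
  exact ⟨Nat.zero_le _, fun a y _ _ => ⟨∅, by simp, rfl, by simp⟩⟩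

lemma Valid.exists_visible_mid (hS : S.Valid) {H : Finset (ℝ × ℝ)} (hH : IsGuardSet S.region H)
    {a : ℕ} {y : ℝ} (ha : a < S.m) (hy : S.l a ≤ y ∧ y ≤ S.u a) :
    ∃ g ∈ H, OrthVisible S.region g (S.mid a y) :=
  hH.2 _ (hS.mid_mem_region ha hy)

/-- An unseen point requires a further guard. -/
lemma LowerBound.succ_le {c e i' a : ℕ} {y : ℝ} (h : S.LowerBound c e i') (hS : S.Valid)
    (ha : a < S.m) (hy : S.Unseen c e i' a y)
    {H : Finset (ℝ × ℝ)} (hH : IsGuardSet S.region H) : c + 1 ≤ H.card := by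
  obtain ⟨B, hB, hc, hv⟩ := (h H hH).2 a y ha hy
  obtain ⟨g, hg, hgv⟩ := hS.exists_visible_mid hH ha hy.2.1
  have : g ∉ B := fun hgB => (hv g hgB).1 hgv
  rw [← hc, ← Finset.card_insert_of_notMem this]
  exact Finset.card_le_card (Finset.insert_subset hg hB)

/-- One more guard is necessary. Of the two unseen points, the first is blocked at slab `k`, so
that its guard stands no further right than the left end of slab `k`; the second lies in slab `i`,
so that its guard has to serve slab `i`. Whatever is unseen afterwards is missed by the guard of
one of them. -/
lemma LowerBound.step {c e i' i k ap : ℕ} {yp yq : ℝ} (h : S.LowerBound c e i') (hS : S.Valid)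
    (hk : k < S.m) (hei : e ≤ i) (hp : S.Unseen c e i' ap yp) (hapk : ap < k)
    (hpk : ¬(S.l k ≤ yp ∧ yp ≤ S.u k)) (hq : S.Unseen c e i' i yq) (hik : i < k) :
    S.LowerBound (c + 1) k i := by
  intro H hH
  refine ⟨h.succ_le hS (hapk.trans hk) hp hH, fun a y ha hy => ?_⟩
  have hka : k ≤ a := hy.1
  have hmono : ∀ {b a' : ℕ} {y' : ℝ}, b < k → S.Hidden k a a' y' → S.Hidden e b a' y' := by
    rintro b a' y' hb ⟨h1, h2, h3⟩
    refine ⟨by omega, by omega, h3.imp (fun h4 h5 => h4 (h5.mono (by omega) le_rfl))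
      (fun h4 z h5 => h4 z (h5.mono (by omega) le_rfl))⟩
  have hself : ∀ {b : ℕ}, b < k → S.Hidden e b a y := by
    intro b hb
    refine ⟨by omega, by omega, ?_⟩
    rcases hy.2.2 with h4 | h4 | h4
    · exact Or.inl fun h5 => h4 (h5.mono (by omega) le_rfl)
    · omega
    · exact Or.inr fun z h5 => h4 z (h5.mono (by omega) le_rfl)
  have build : ∀ b yb, b < k → S.Unseen c e i' b yb →
      (∀ g, OrthVisible S.region g (S.mid b yb) → ¬OrthVisible S.region g (S.mid a y) ∧
        ∀ a' y', a' < S.m → S.Hidden k a a' y' → ¬OrthVisible S.region g (S.mid a' y')) →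
      ∃ B ⊆ H, B.card = c + 1 ∧ ∀ g ∈ B, ¬OrthVisible S.region g (S.mid a y) ∧
        ∀ a' y', a' < S.m → S.Hidden k a a' y' → ¬OrthVisible S.region g (S.mid a' y') := by
    intro b yb hb hub hg
    obtain ⟨B, hB, hc, hv⟩ := (h H hH).2 b yb (hb.trans hk) hub
    obtain ⟨g, hgH, hgv⟩ := hS.exists_visible_mid hH (hb.trans hk) hub.2.1
    have hgB : g ∉ B := fun hgB => (hv g hgB).1 hgv
    refine ⟨insert g B, Finset.insert_subset hgH hB, by rw [Finset.card_insert_of_notMem hgB, hc],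
      fun g' hg' => ?_⟩
    rcases Finset.mem_insert.1 hg' with rfl | hg'
    · exact hg _ hgv
    · exact ⟨(hv g' hg').2 a y ha (hself hb),
        fun a' y' ha' hh => (hv g' hg').2 a' y' ha' (hmono hb hh)⟩
  rcases hy.2.2 with h4 | h4 | h4
  · refine build ap yp hapk hp fun g hgv => ?_
    have hgx := hS.le_of_visible_of_blocked hapk hk hgv hpk
    have blocked : ∀ a' y', a' < S.m → ¬S.Clear y' k (a' + 1) →
        ¬OrthVisible S.region g (S.mid a' y') := by
      intro a' y' ha' hcl hgv'
      obtain ⟨j, h5, h6, h7⟩ := not_clear_iff.1 hcl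
      exact (hS.lt_of_visible_of_blocked h5 (Nat.lt_succ_iff.1 h6) ha' hgv' h7).not_ge hgx
    refine ⟨blocked a y ha h4, fun a' y' ha' hh => ?_⟩
    rcases hh.2.2 with h5 | h5
    · exact blocked a' y' ha' h5
    · exact fun hgv' => h5 g.2 (hS.clear_of_visible_of_le ha' hgx hgv')
  · omega
  · refine build i yq hik hq fun g hgv => ?_
    have key : ∀ a' y', a' < S.m → a ≤ a' → ¬OrthVisible S.region g (S.mid a' y') := by
      intro a' y' ha' haa hgv'
      exact h4 g.2 ((hS.clear_of_visible_two ha' hgv hgv').mono le_rfl (by omega))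
    exact ⟨key a y ha le_rfl, fun a' y' ha' hh => key a' y' ha' hh.1⟩

/-! ### The greedy sweep -/

/-- State of the sweep: the number `c` of guards placed so far, with coordinates `X`, `Y`; whether
the slabs that the last guard has to serve still have a common level (`kv = 1`), and the interval
`[kl, kh]` of these levels; the interval `[jl, jh]` of levels seen by the last guard in the current
slab; whether there are unseen points (`act = 1`), the hull `[ul, uh]` of their levels and the
interval `[nl, nh]` of levels common to all slabs since the first unseen point. -/
structure Sweep where
  c : ℕ
  kv : ℕ
  act : ℕ
  kl : ℝ
  kh : ℝ
  jl : ℝ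
  jh : ℝ
  ul : ℝ
  uh : ℝ
  nl : ℝ
  nh : ℝ
  X : ℕ → ℝ
  Y : ℕ → ℝ

namespace Sweep

/-- Place a guard at abscissa `x`, serving all unseen points. -/
noncomputable def place (x : ℝ) (s : Sweep) : Sweep :=
  { s with c := s.c + 1, X := Function.update s.X s.c x, Y := Function.update s.Y s.c s.nl }

open Classical in
/-- If some unseen point cannot be seen from beyond abscissa `x`, place a guard there. -/
noncomputable def commit (x l u : ℝ) (s : Sweep) : Sweep :=
  if s.act = 1 ∧ ¬(¬ s.ul < l ∧ ¬ u < s.uh) then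
    { s.place x with kv := 1, act := 0, kl := s.nl, kh := s.nh, jl := l, jh := u }
  else s

open Classical in
/-- Update the levels at which the last guard may stand, and let it stand at the lowest of them as
long as there are any. -/
noncomputable def serve (l u : ℝ) (s : Sweep) : Sweep :=
  if s.kv = 1 then
    if min s.kh u < max s.kl l then { s with kv := 0, kl := max s.kl l, kh := min s.kh u }
    else { s with kl := max s.kl l, kh := min s.kh u,
                  Y := Function.update s.Y (s.c - 1) (max s.kl l) }
  else s

/-- Update the levels that the last guard sees. If it sees nothing in the slab, then `jl = u` and
`jh = l`, so that all levels of the slab lie below `jl` or above `jh`. -/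
noncomputable def view (l u : ℝ) (s : Sweep) : Sweep :=
  if s.kv = 1 then { s with jl := max s.jl l, jh := min s.jh u } else { s with jl := u, jh := l }

/-- If there are no unseen points, start with lower end `u` and upper end `l`: taking minima and maxima
with levels of the current slab `[l, u]` then yields the hull of these levels. -/
noncomputable def start (l u : ℝ) (s : Sweep) : Sweep :=
  if s.act = 0 then { s with ul := u, uh := l, nl := l, nh := u } else s

open Classical in
/-- Add the unseen points below the levels that the last guard sees. -/
noncomputable def addLow (l : ℝ) (s : Sweep) : Sweep :=
  if l < s.jl then { s with act := 1, ul := min s.ul l, uh := max s.uh s.jl } else s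

open Classical in
/-- Add the unseen points above the levels that the last guard sees. -/
noncomputable def addHigh (u : ℝ) (s : Sweep) : Sweep :=
  if s.jh < u then { s with act := 1, ul := min s.ul s.jh, uh := max s.uh u } else s

/-- Update the levels at which the next guard may stand. -/
noncomputable def narrow (l u : ℝ) (s : Sweep) : Sweep :=
  { s with nl := max s.nl l, nh := min s.nh u }

/-- Process one slab. -/
noncomputable def step (x l u : ℝ) (s : Sweep) : Sweep :=
  narrow l u (addHigh u (addLow l (start l u (view l u (serve l u (commit x l u s))))))

/-- After the last slab, place a guard at its right end if there are unseen points. -/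
noncomputable def finish (x : ℝ) (s : Sweep) : Sweep :=
  if s.act = 1 then s.place x else s

/-- The sweep started in state `s₀`, after `k` slabs. -/
noncomputable def run (S : Slabs) (s₀ : Sweep) : ℕ → Sweep
  | 0 => s₀
  | k + 1 => step (S.x k) (S.l k) (S.u k) (run S s₀ k)

end Sweep

/-! ### The invariant of the sweep -/

/-- The facts about the guards placed before slab `k`: the last of them stands at the left end of
slab `e`, and at its level slabs `i'` to `R - 1` are clear. -/
structure GuardInv (S : Slabs) (s : Sweep) (k e i' R : ℕ) : Prop where
  le : k ≤ S.m
  e_le : e ≤ k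
  e_zero : s.c = 0 → e = 0
  last : 0 < s.c → s.X (s.c - 1) = S.x e ∧ i' < e ∧ e ≤ R ∧ R ≤ k ∧ S.Clear (s.Y (s.c - 1)) i' R
  mem : ∀ j, j + 1 < s.c → (s.X j, s.Y j) ∈ S.region
  strict : ∀ i j, i < j → j < s.c → s.X i < s.X j
  valid : s.kv = 1 → 0 < s.c ∧ R = k ∧ s.kl ≤ s.kh ∧
    ∀ y, (s.kl ≤ y ∧ y ≤ s.kh) ↔ S.Clear y i' k
  invalid : s.kv ≠ 1 → s.c = 0 ∨ ∀ z, ¬S.Clear z i' k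
  lower : S.LowerBound s.c e i'

/-- The point at height `y` of slab `a` is seen by a guard before the last one, or by the last
guard. The level of the last guard is left open, because it still changes. -/
def Seen (S : Slabs) (s : Sweep) (e i' R a : ℕ) (y : ℝ) : Prop :=
  (∃ j, j + 1 < s.c ∧ S.SeesRow (s.X j, s.Y j) a y) ∨
  (0 < s.c ∧ i' ≤ a ∧ a < R ∧ (a < e → S.Clear y a e) ∧ (e ≤ a → S.Clear y e (a + 1)))

/-- `[lo, hi]` is contained in every closed interval that contains `A`. The ends need not belong to
`A`, which may be half open. -/
def Tight (lo hi : ℝ) (A : Set ℝ) : Prop :=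
  (∀ z < hi, ∃ y ∈ A, z < y) ∧ ∀ z, lo < z → ∃ y ∈ A, y < z

/-- Levels in `[lo, hi]` of the unseen points of slabs `i, …, k - 1` that are clear up to slab
`k - 1`. -/
def pending (S : Slabs) (c e i' i k : ℕ) (lo hi : ℝ) : Set ℝ :=
  {y | (lo ≤ y ∧ y ≤ hi) ∧ ∃ a, i ≤ a ∧ a < k ∧ S.Unseen c e i' a y ∧ S.Clear y a k}

/-- The facts about the unseen points before slab `k`; slab `i` is the first that contains some. -/
structure PendInv (S : Slabs) (s : Sweep) (k e i' i : ℕ) : Prop where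
  e_le : e ≤ i
  lt : i < k
  levels : ∀ y, (s.nl ≤ y ∧ y ≤ s.nh) ↔ S.Clear y i k
  tight : Tight s.ul s.uh (S.pending s.c e i' i k s.ul s.uh)
  first : ∃ y, (s.ul ≤ y ∧ y ≤ s.uh) ∧ S.Unseen s.c e i' i y ∧ S.Clear y i k

/-- The invariant of the sweep before slab `k`. -/
structure Inv (S : Slabs) (s : Sweep) (k e i' i R : ℕ) : Prop where
  guards : S.GuardInv s k e i' R
  act01 : s.act = 0 ∨ s.act = 1
  views : s.kv = 1 → e < k ∧ ∀ y, (s.jl ≤ y ∧ y ≤ s.jh) ↔ S.Clear y e k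
  pend : s.act = 1 → S.PendInv s k e i' i
  cover : ∀ a < k, ∀ y, S.l a ≤ y ∧ y ≤ S.u a → S.Seen s e i' R a y ∨
    (s.act = 1 ∧ i ≤ a ∧ (s.ul ≤ y ∧ y ≤ s.uh) ∧ S.Clear y a k)

lemma Tight.mono {lo hi : ℝ} {A B : Set ℝ} (h : Tight lo hi A) (hAB : A ⊆ B) : Tight lo hi B :=
  ⟨fun z hz => (h.1 z hz).imp fun _ hy => ⟨hAB hy.1, hy.2⟩,
    fun z hz => (h.2 z hz).imp fun _ hy => ⟨hAB hy.1, hy.2⟩⟩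

lemma Tight.union {lo hi lo' hi' : ℝ} {A : Set ℝ} (h : Tight lo hi A) (h' : Tight lo' hi' A) :
    Tight (min lo lo') (max hi hi') A := by
  constructor
  · intro z hz
    rcases lt_max_iff.1 hz with hz | hz
    exacts [h.1 z hz, h'.1 z hz]
  · intro z hz
    rcases min_lt_iff.1 hz with hz | hz
    exacts [h.2 z hz, h'.2 z hz]

end Slabs

/-! ### The sweep keeps its invariant -/

namespace Slabs

variable {S : Slabs}

/-- The invariant after the decision whether to place a guard at the left end of slab `k`. -/
structure CommitInv (S : Slabs) (s : Sweep) (k e i' i R : ℕ) : Prop where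
  guards : S.GuardInv s k e i' R
  act01 : s.act = 0 ∨ s.act = 1
  views : s.kv = 1 → ∀ y, (max s.jl (S.l k) ≤ y ∧ y ≤ min s.jh (S.u k)) ↔ S.Clear y e (k + 1)
  pend : s.act = 1 → S.PendInv s k e i' i
  fits : s.act = 1 → S.l k ≤ s.ul ∧ s.uh ≤ S.u k
  cover : ∀ a < k, ∀ y, S.l a ≤ y ∧ y ≤ S.u a → S.Seen s e i' R a y ∨
    (s.act = 1 ∧ i ≤ a ∧ (s.ul ≤ y ∧ y ≤ s.uh) ∧ S.Clear y a k)

/-- The last guard sees the points that count as seen by it. -/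
lemma seesRow_last (hS : S.Valid) {s : Sweep} {k e i' R : ℕ} (h : S.GuardInv s k e i' R)
    {a : ℕ} {y : ℝ} (hc : 0 < s.c) (h1 : i' ≤ a) (h2 : a < R) (h3 : a < e → S.Clear y a e)
    (h4 : e ≤ a → S.Clear y e (a + 1)) : S.SeesRow (s.X (s.c - 1), s.Y (s.c - 1)) a y := by
  obtain ⟨h5, h6, h7, h8, h9⟩ := h.last hc
  have hm := h.le
  have he := h.e_le
  rw [h5]
  rcases lt_or_ge a e with h | h
  · exact hS.seesRow_left h (by omega) (h9.mono h1 h7) (h3 h)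
  · exact hS.seesRow_right h (by omega) (h9.mono (by omega) (by omega)) (h4 h)

lemma mem_region_last (hS : S.Valid) {s : Sweep} {k e i' R : ℕ} (h : S.GuardInv s k e i' R)
    (hc : 0 < s.c) : (s.X (s.c - 1), s.Y (s.c - 1)) ∈ S.region := by
  obtain ⟨h5, h6, h7, h8, h9⟩ := h.last hc
  have hm := h.le
  have he := h.e_le
  obtain ⟨e, rfl⟩ : ∃ d, e = d + 1 := ⟨e - 1, by omega⟩
  rw [h5]
  exact ⟨e, by omega, ⟨(hS.x_lt e (by omega)).le, le_rfl⟩, h9 e (by omega) (by omega)⟩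

/-- What remains true when a guard is placed at the left end of slab `k`. -/
lemma Inv.place (hS : S.Valid) {s t : Sweep} {k e i' i R : ℕ} (h : S.Inv s k e i' i R)
    (hact : s.act = 1) (hc : t.c = s.c + 1) (hX : t.X = Function.update s.X s.c (S.x k))
    (hY : t.Y = Function.update s.Y s.c s.nl) :
    (0 < t.c ∧ t.X (t.c - 1) = S.x k ∧ i < k ∧ S.Clear (t.Y (t.c - 1)) i k) ∧
    (∀ j, j + 1 < t.c → (t.X j, t.Y j) ∈ S.region) ∧
    (∀ i j, i < j → j < t.c → t.X i < t.X j) ∧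
    (s.nl ≤ s.nh) ∧
    (∀ a < k, ∀ y, S.l a ≤ y ∧ y ≤ S.u a → S.Seen t k i k a y) := by
  have hp := h.pend hact
  have hg := h.guards
  have hn : s.nl ≤ s.nh := by
    obtain ⟨y, -, -, hy⟩ := hp.first
    have := (hp.levels y).2 hy
    exact this.1.trans this.2
  have hold : ∀ j, j < s.c → t.X j = s.X j ∧ t.Y j = s.Y j := by
    intro j hj
    rw [hX, hY, Function.update_of_ne hj.ne, Function.update_of_ne hj.ne]
    exact ⟨rfl, rfl⟩
  have hXc : t.X s.c = S.x k := by rw [hX, Function.update_self]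
  refine ⟨⟨by omega, ?_, hp.lt, ?_⟩, ?_, ?_, hn, ?_⟩
  · rw [hc, Nat.add_sub_cancel, hXc]
  · rw [hc, Nat.add_sub_cancel, hY, Function.update_self]
    exact (hp.levels _).1 ⟨le_rfl, hn⟩
  · intro j hj
    obtain ⟨e1, e2⟩ := hold j (by omega)
    rw [e1, e2]
    by_cases hj' : j + 1 < s.c
    · exact hg.mem j hj'
    · obtain rfl : j = s.c - 1 := by omega
      exact mem_region_last hS hg (by omega)
  · intro a b hab hb
    rcases Nat.lt_succ_iff_lt_or_eq.1 (hc ▸ hb : b < s.c + 1) with hb' | rfl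
    · rw [(hold a (hab.trans hb')).1, (hold b hb').1]
      exact hg.strict a b hab hb'
    · rw [(hold a hab).1, hXc]
      have h1 : s.X a ≤ s.X (s.c - 1) := by
        rcases (show a ≤ s.c - 1 by omega).eq_or_lt with h2 | h2
        · rw [h2]
        · exact (hg.strict a _ h2 (by omega)).le
      have h2 := (hg.last (by omega)).1
      have h3 : S.x e < S.x k := hS.x_lt_of_lt (hp.e_le.trans_lt hp.lt) hg.le
      linarith
  · intro a ha y hy
    rcases h.cover a ha y hy with (⟨j, hj, hs⟩ | ⟨h1, h2, h3, h4, h5⟩) | ⟨-, h2, h3, h4⟩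
    · refine Or.inl ⟨j, by omega, ?_⟩
      rw [(hold j (by omega)).1, (hold j (by omega)).2]
      exact hs
    · refine Or.inl ⟨s.c - 1, by omega, ?_⟩
      rw [(hold _ (by omega)).1, (hold _ (by omega)).2]
      exact seesRow_last hS hg h1 h2 h3 h4 h5
    · exact Or.inr ⟨by omega, h2, ha, fun _ => h4, fun h => absurd ha h.not_gt⟩

/-- If the hull of the unseen points does not fit into slab `k`, a guard is placed and everything
before slab `k` is seen; otherwise nothing changes. -/
lemma Inv.commit (hS : S.Valid) {s : Sweep} {k e i' i R : ℕ} (h : S.Inv s k e i' i R)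
    (hk : k < S.m) :
    ∃ e' i'' R', S.CommitInv (s.commit (S.x k) (S.l k) (S.u k)) k e' i'' i R' := by
  by_cases hc : s.act = 1 ∧ ¬(¬ s.ul < S.l k ∧ ¬ S.u k < s.uh)
  · obtain ⟨hact, hfit⟩ := hc
    rw [Sweep.commit, if_pos ⟨hact, hfit⟩]
    set t : Sweep := { s.place (S.x k) with
      kv := 1, act := 0, kl := s.nl, kh := s.nh, jl := S.l k, jh := S.u k } with ht
    obtain ⟨⟨p1, p2, p3, p4⟩, p5, p6, p7, p8⟩ := h.place hS (t := t) hact rfl rfl rfl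
    have hp := h.pend hact
    -- The hull does not fit into slab `k`; it is tight, so some unseen point does not fit either.
    have hblock : ∃ y ∈ S.pending s.c e i' i k s.ul s.uh, ¬(S.l k ≤ y ∧ y ≤ S.u k) := by
      rcases not_and_or.1 hfit with h1 | h1
      · obtain ⟨y, hy, h2⟩ := hp.tight.2 _ (not_not.1 h1)
        exact ⟨y, hy, fun h3 => h3.1.not_gt h2⟩
      · obtain ⟨y, hy, h2⟩ := hp.tight.1 _ (not_not.1 h1)
        exact ⟨y, hy, fun h3 => h3.2.not_gt h2⟩
    obtain ⟨yp, ⟨-, ap, ha1, ha2, ha3, -⟩, hyp⟩ := hblock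
    obtain ⟨yq, -, hq, -⟩ := hp.first
    refine ⟨k, i, k, ⟨⟨h.guards.le, le_rfl, by omega, fun _ => ⟨p2, p3, le_rfl, le_rfl, p4⟩, p5, p6,
      fun _ => ⟨p1, rfl, p7, hp.levels⟩, fun h => absurd rfl h, ?_⟩, Or.inl rfl, ?_, ?_, ?_,
      fun a ha y hy => Or.inl (p8 a ha y hy)⟩⟩
    · exact h.guards.lower.step hS hk hp.e_le ha3 ha2 hyp hq hp.lt
    · intro _ y
      rw [show t.jl = S.l k from rfl, show t.jh = S.u k from rfl, max_self, min_self,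
        clear_succ le_rfl]
      exact ⟨fun h => ⟨fun j h1 h2 => absurd h1 h2.not_ge, h⟩, fun h => h.2⟩
    · intro h; exact absurd h (by simp [ht])
    · intro h; exact absurd h (by simp [ht])
  · rw [Sweep.commit, if_neg hc]
    refine ⟨e, i', R, ⟨h.guards, h.act01, fun hkv y => ?_, h.pend, fun hact => ?_, h.cover⟩⟩
    · obtain ⟨h1, h2⟩ := h.views hkv
      rw [clear_succ h1.le, ← h2 y, max_le_iff, le_min_iff]
      exact and_and_and_comm
    · have : ¬ s.ul < S.l k ∧ ¬ S.u k < s.uh := by tauto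
      exact ⟨not_lt.1 this.1, not_lt.1 this.2⟩

lemma GuardInv.serve {s : Sweep} {k e i' R : ℕ} (h : S.GuardInv s k e i' R) (hk : k < S.m) :
    ∃ R', R ≤ R' ∧ ((s.serve (S.l k) (S.u k)).kv = 1 → R' = k + 1) ∧
      S.GuardInv (s.serve (S.l k) (S.u k)) (k + 1) e i' R' := by
  have hek := h.e_le
  by_cases hkv : s.kv = 1
  · obtain ⟨h1, rfl, h3, h4⟩ := h.valid hkv
    obtain ⟨h5, h6, h7, h8, h9⟩ := h.last h1
    have hK : ∀ y, (max s.kl (S.l R) ≤ y ∧ y ≤ min s.kh (S.u R)) ↔ S.Clear y i' (R + 1) := by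
      intro y
      rw [clear_succ (by omega), ← h4, max_le_iff, le_min_iff]
      exact and_and_and_comm
    by_cases hlt : min s.kh (S.u R) < max s.kl (S.l R)
    · rw [Sweep.serve, if_pos hkv, if_pos hlt]
      refine ⟨R, le_rfl, fun h => absurd h (by simp), ⟨hk, by omega, h.e_zero,
        fun _ => ⟨h5, h6, h7, by omega, h9⟩, h.mem, h.strict, fun h => absurd h (by simp),
        fun _ => Or.inr fun z hz => ?_, h.lower⟩⟩
      have := (hK z).2 hz
      linarith
    · rw [Sweep.serve, if_pos hkv, if_neg hlt]
      refine ⟨R + 1, by omega, fun _ => rfl, ⟨hk, by omega, h.e_zero,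
        fun _ => ⟨h5, h6, by omega, le_rfl, ?_⟩, ?_, h.strict,
        fun _ => ⟨h1, rfl, not_lt.1 hlt, hK⟩, fun h => absurd hkv h, h.lower⟩⟩
      · dsimp only
        rw [Function.update_self]
        exact (hK _).1 ⟨le_rfl, not_lt.1 hlt⟩
      · intro j hj
        dsimp only at hj ⊢
        rw [Function.update_of_ne (by omega)]
        exact h.mem j hj
  · rw [Sweep.serve, if_neg hkv]
    refine ⟨R, le_rfl, fun h => absurd h hkv, ⟨hk, by omega, h.e_zero, fun hc => ?_, h.mem, h.strict,
      fun h => absurd h hkv, fun _ => (h.invalid hkv).imp_right fun h z hz =>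
        h z (hz.mono le_rfl (Nat.le_succ k)), h.lower⟩⟩
    obtain ⟨h5, h6, h7, h8, h9⟩ := h.last hc
    exact ⟨h5, h6, h7, by omega, h9⟩

namespace Sweep

/-- The part of the treatment of a slab that concerns the unseen points. -/
noncomputable def collect (l u : ℝ) (s : Sweep) : Sweep :=
  narrow l u (addHigh u (addLow l (start l u (view l u s))))

variable (l u : ℝ) (s : Sweep)

lemma collect_c : (s.collect l u).c = s.c := by
  simp only [collect, narrow, addHigh, addLow, start, view]; split_ifs <;> rfl
lemma collect_kv : (s.collect l u).kv = s.kv := by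
  simp only [collect, narrow, addHigh, addLow, start, view]; split_ifs <;> rfl
lemma collect_kl : (s.collect l u).kl = s.kl := by
  simp only [collect, narrow, addHigh, addLow, start, view]; split_ifs <;> rfl
lemma collect_kh : (s.collect l u).kh = s.kh := by
  simp only [collect, narrow, addHigh, addLow, start, view]; split_ifs <;> rfl
lemma collect_X : (s.collect l u).X = s.X := by
  simp only [collect, narrow, addHigh, addLow, start, view]; split_ifs <;> rfl
lemma collect_Y : (s.collect l u).Y = s.Y := by
  simp only [collect, narrow, addHigh, addLow, start, view]; split_ifs <;> rfl
lemma collect_jl : (s.collect l u).jl = if s.kv = 1 then max s.jl l else u := by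
  simp only [collect, narrow, addHigh, addLow, start, view]; split_ifs <;> rfl
lemma collect_jh : (s.collect l u).jh = if s.kv = 1 then min s.jh u else l := by
  simp only [collect, narrow, addHigh, addLow, start, view]; split_ifs <;> rfl

variable {l u s}

lemma collect_nl_nh_of_act (h : s.act = 1) :
    (s.collect l u).nl = max s.nl l ∧ (s.collect l u).nh = min s.nh u := by
  simp only [collect, narrow, addHigh, addLow, start, view]; split_ifs <;> simp_all
lemma collect_nl_nh_of_not_act (h : s.act = 0) :
    (s.collect l u).nl = l ∧ (s.collect l u).nh = u := by
  simp only [collect, narrow, addHigh, addLow, start, view]; split_ifs <;> simp_all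

lemma collect_act01 (h : s.act = 0 ∨ s.act = 1) :
    (s.collect l u).act = 0 ∨ (s.collect l u).act = 1 := by
  simp only [collect, narrow, addHigh, addLow, start, view]; split_ifs <;> simp_all

lemma collect_of_act (h : s.act = 1) : (s.collect l u).act = 1 ∧
    (s.collect l u).ul ≤ s.ul ∧ s.uh ≤ (s.collect l u).uh := by
  simp only [collect, narrow, addHigh, addLow, start, view]; split_ifs <;> simp_all

lemma collect_low (h : l < (s.collect l u).jl) : (s.collect l u).act = 1 ∧
    (s.collect l u).ul ≤ l ∧ (s.collect l u).jl ≤ (s.collect l u).uh := by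
  revert h
  simp only [collect, narrow, addHigh, addLow, start, view]; split_ifs <;> simp_all

lemma collect_high (h : (s.collect l u).jh < u) : (s.collect l u).act = 1 ∧
    (s.collect l u).ul ≤ (s.collect l u).jh ∧ u ≤ (s.collect l u).uh := by
  revert h
  simp only [collect, narrow, addHigh, addLow, start, view]; split_ifs <;> simp_all

lemma act_of_collect (h : (s.collect l u).act = 1) :
    s.act = 1 ∨ l < (s.collect l u).jl ∨ (s.collect l u).jh < u := by
  revert h
  simp only [collect, narrow, addHigh, addLow, start, view]; split_ifs <;> simp_all

/-- The hull stays tight. -/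
lemma collect_tight {A : Set ℝ} (h01 : s.act = 0 ∨ s.act = 1)
    (hl : (s.collect l u).jl ≤ u) (hh : l ≤ (s.collect l u).jh)
    (h0 : s.act = 1 → Tight s.ul s.uh A)
    (h1 : l < (s.collect l u).jl → Tight l (s.collect l u).jl A)
    (h2 : (s.collect l u).jh < u → Tight (s.collect l u).jh u A)
    (h : (s.collect l u).act = 1) : Tight (s.collect l u).ul (s.collect l u).uh A := by
  have e1 : (start l u (view l u s)).jl = (s.collect l u).jl := by
    simp only [collect, narrow, addHigh, addLow, start, view]; split_ifs <;> rfl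
  have e2 : (addLow l (start l u (view l u s))).jh = (s.collect l u).jh := by
    simp only [collect, narrow, addHigh, addLow, start, view]; split_ifs <;> rfl
  have e3 : (start l u (view l u s)).act = s.act := by
    simp only [start, view]; split_ifs <;> rfl
  revert h
  rw [collect] at *
  set t := start l u (view l u s) with ht
  generalize (narrow l u (addHigh u (addLow l t))).jl = A' at *
  generalize (narrow l u (addHigh u (addLow l t))).jh = B' at *
  simp only [narrow]
  have hstart : (s.act = 1 ∧ Tight t.ul t.uh A) ∨ (s.act = 0 ∧ t.ul = u ∧ t.uh = l) := by
    rcases h01 with h | h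
    · right
      have : (view l u s).act = 0 := by rw [← h]; simp only [view]; split_ifs <;> rfl
      simp [ht, start, this, h]
    · left
      have : (view l u s).act = 1 := by rw [← h]; simp only [view]; split_ifs <;> rfl
      have e4 : t.ul = s.ul ∧ t.uh = s.uh := by
        simp only [ht, start, view]; split_ifs <;> simp_all
      rw [e4.1, e4.2]
      exact ⟨h, h0 h⟩
  simp only [addHigh, e2]
  by_cases hB : B' < u
  · rw [if_pos hB]
    rw [addLow, e1]
    split_ifs with hA
    · intro _
      dsimp only
      rcases hstart with ⟨-, h⟩ | ⟨-, h, h'⟩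
      · exact (h.union (h1 hA)).union (h2 hB)
      · have := (h1 hA).union (h2 hB)
        rwa [h, h', min_eq_right (hA.le.trans hl), max_eq_right hA.le]
    · intro _
      dsimp only
      rcases hstart with ⟨-, h⟩ | ⟨-, h, h'⟩
      · exact h.union (h2 hB)
      · have := h2 hB
        rwa [h, h', min_eq_right hB.le, max_eq_right (hh.trans hB.le)]
  · rw [if_neg hB, addLow, e1]
    split_ifs with hA
    · intro _
      dsimp only
      rcases hstart with ⟨-, h⟩ | ⟨-, h, h'⟩
      · exact h.union (h1 hA)
      · have := h1 hA
        rwa [h, h', min_eq_right (hA.le.trans hl), max_eq_right hA.le]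
    · intro hact
      rcases hstart with ⟨-, h⟩ | ⟨h, -⟩
      · exact h
      · rw [e3, h] at hact
        exact absurd hact (by simp)

end Sweep

end Slabs

namespace Slabs

variable {S : Slabs}

lemma CommitInv.step (hS : S.Valid) {t : Sweep} {k e i' i R : ℕ} (h : S.CommitInv t k e i' i R)
    (hk : k < S.m) :
    ∃ i₁ R', S.Inv ((t.serve (S.l k) (S.u k)).collect (S.l k) (S.u k)) (k + 1) e i' i₁ R' := by
  obtain ⟨R', hRR, hR', hg⟩ := h.guards.serve hk
  obtain ⟨s, hs⟩ : ∃ s, s = t.serve (S.l k) (S.u k) := ⟨_, rfl⟩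
  rw [← hs] at hR' hg ⊢
  have sc : s.c = t.c := by rw [hs, Sweep.serve]; split_ifs <;> rfl
  have sX : s.X = t.X := by rw [hs, Sweep.serve]; split_ifs <;> rfl
  have sY : ∀ j, j + 1 < t.c → s.Y j = t.Y j := by
    intro j hj
    rw [hs, Sweep.serve]; split_ifs <;> try rfl
    exact Function.update_of_ne (by omega) _ _
  have sact : s.act = t.act := by rw [hs, Sweep.serve]; split_ifs <;> rfl
  have sul : s.ul = t.ul := by rw [hs, Sweep.serve]; split_ifs <;> rfl
  have suh : s.uh = t.uh := by rw [hs, Sweep.serve]; split_ifs <;> rfl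
  have snl : s.nl = t.nl := by rw [hs, Sweep.serve]; split_ifs <;> rfl
  have snh : s.nh = t.nh := by rw [hs, Sweep.serve]; split_ifs <;> rfl
  have sjl : s.jl = t.jl := by rw [hs, Sweep.serve]; split_ifs <;> rfl
  have sjh : s.jh = t.jh := by rw [hs, Sweep.serve]; split_ifs <;> rfl
  have skv : s.kv = 1 → t.kv = 1 := by rw [hs, Sweep.serve]; split_ifs <;> simp_all
  have hlu := hS.l_lt k hk
  have hek := h.guards.e_le
  obtain ⟨r, hr⟩ : ∃ r, r = s.collect (S.l k) (S.u k) := ⟨_, rfl⟩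
  rw [← hr]
  have rc : r.c = s.c := by rw [hr, Sweep.collect_c]
  have rkv : r.kv = s.kv := by rw [hr, Sweep.collect_kv]
  have rX : r.X = s.X := by rw [hr, Sweep.collect_X]
  have rY : r.Y = s.Y := by rw [hr, Sweep.collect_Y]
  have rgi : S.GuardInv r (k + 1) e i' R' := by
    refine ⟨hg.le, hg.e_le, ?_, ?_, ?_, ?_, ?_, ?_, ?_⟩
    · rw [rc]; exact hg.e_zero
    · rw [rc, rX, rY]; exact hg.last
    · rw [rc, rX, rY]; exact hg.mem
    · rw [rc, rX]; exact hg.strict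
    · rw [rc, rkv, show r.kl = s.kl by rw [hr, Sweep.collect_kl],
        show r.kh = s.kh by rw [hr, Sweep.collect_kh]]
      exact hg.valid
    · rw [rc, rkv]; exact hg.invalid
    · rw [rc]; exact hg.lower
  have hJ : r.kv = 1 → ∀ y, (r.jl ≤ y ∧ y ≤ r.jh) ↔ S.Clear y e (k + 1) := by
    intro hkv y
    rw [rkv] at hkv
    rw [hr, Sweep.collect_jl, Sweep.collect_jh, if_pos hkv, if_pos hkv, sjl, sjh]
    exact h.views (skv hkv) y
  have hJ0 : r.kv ≠ 1 → r.jl = S.u k ∧ r.jh = S.l k := by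
    intro hkv
    rw [rkv] at hkv
    rw [hr, Sweep.collect_jl, Sweep.collect_jh, if_neg hkv, if_neg hkv]
    exact ⟨rfl, rfl⟩
  have hbd : S.l k ≤ r.jl ∧ r.jl ≤ S.u k ∧ S.l k ≤ r.jh ∧ r.jh ≤ S.u k := by
    by_cases hkv : r.kv = 1
    · obtain ⟨h1, h2, h3, h4⟩ := rgi.valid hkv
      have hle : i' ≤ e := (rgi.last h1).2.1.le
      have hcl : S.Clear r.kl e (k + 1) := ((h4 r.kl).1 ⟨le_rfl, h3⟩).mono hle le_rfl
      have h5 := (hJ hkv _).2 hcl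
      have h6 : r.jl ≤ r.jh := h5.1.trans h5.2
      have h7 := (hJ hkv _).1 ⟨le_rfl, h6⟩ k hek (Nat.lt_succ_self k)
      have h8 := (hJ hkv _).1 ⟨h6, le_rfl⟩ k hek (Nat.lt_succ_self k)
      exact ⟨h7.1, h7.2, h8⟩
    · obtain ⟨h1, h2⟩ := hJ0 hkv
      rw [h1, h2]
      exact ⟨hlu.le, le_rfl, le_rfl, hlu.le⟩
  obtain ⟨hb1, hb2, hb3, hb4⟩ := hbd
  have hun : ∀ y, S.l k ≤ y → y ≤ S.u k → (y < r.jl ∨ r.jh < y) → S.Unseen r.c e i' k y := by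
    intro y h1 h2 h3
    refine ⟨hek, ⟨h1, h2⟩, ?_⟩
    by_cases hkv : r.kv = 1
    · refine Or.inl fun h4 => ?_
      have := (hJ hkv y).2 h4
      rcases h3 with h3 | h3 <;> linarith [this.1, this.2]
    · exact Or.inr (rgi.invalid hkv)
  -- The first slab with unseen points.
  set i₁ : ℕ := if t.act = 1 then i else k with hi₁
  have hi₁k : i₁ ≤ k := by
    rw [hi₁]; split_ifs with hact
    exacts [(h.pend hact).lt.le, le_rfl]
  have hact01 : s.act = 0 ∨ s.act = 1 := by rw [sact]; exact h.act01
  have hpmem : ∀ y, S.l k ≤ y → y ≤ S.u k → (y < r.jl ∨ r.jh < y) → r.ul ≤ y → y ≤ r.uh →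
      y ∈ S.pending r.c e i' i₁ (k + 1) r.ul r.uh := by
    intro y h1 h2 h3 h4 h5
    refine ⟨⟨h4, h5⟩, k, hi₁k, Nat.lt_succ_self k, hun y h1 h2 h3, ?_⟩
    intro j h6 h7
    obtain rfl : j = k := by omega
    exact ⟨h1, h2⟩
  have hold : t.act = 1 → r.act = 1 ∧ r.ul ≤ t.ul ∧ t.uh ≤ r.uh := by
    intro hact
    have := Sweep.collect_of_act (l := S.l k) (u := S.u k) (s := s) (by rw [sact]; exact hact)
    rw [sul, suh, ← hr] at this
    exact this
  have hlow : S.l k < r.jl → r.act = 1 ∧ r.ul ≤ S.l k ∧ r.jl ≤ r.uh := by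
    rw [hr]; exact Sweep.collect_low
  have hhigh : r.jh < S.u k → r.act = 1 ∧ r.ul ≤ r.jh ∧ S.u k ≤ r.uh := by
    rw [hr]; exact Sweep.collect_high
  refine ⟨i₁, R', rgi, hr ▸ Sweep.collect_act01 hact01,
    fun hkv => ⟨Nat.lt_succ_of_le hek, hJ hkv⟩, fun hact => ?_, ?_⟩
  · refine ⟨?_, Nat.lt_succ_of_le hi₁k, ?_, ?_, ?_⟩
    · rw [hi₁]; split_ifs with ha
      exacts [(h.pend ha).e_le, hek]
    · intro y
      rw [clear_succ hi₁k]
      rcases h.act01 with ha | ha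
      · obtain ⟨h1, h2⟩ := Sweep.collect_nl_nh_of_not_act (l := S.l k) (u := S.u k) (s := s)
          (by rw [sact]; exact ha)
        rw [← hr] at h1 h2
        rw [h1, h2, hi₁, if_neg (by omega)]
        exact ⟨fun h => ⟨fun j h1 h2 => absurd h1 h2.not_ge, h⟩, fun h => h.2⟩
      · obtain ⟨h1, h2⟩ := Sweep.collect_nl_nh_of_act (l := S.l k) (u := S.u k) (s := s)
          (by rw [sact]; exact ha)
        rw [← hr] at h1 h2
        rw [h1, h2, hi₁, if_pos ha, snl, snh,
          ← (h.pend ha).levels y, max_le_iff, le_min_iff]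
        exact and_and_and_comm
    · have htight := Sweep.collect_tight (l := S.l k) (u := S.u k) (s := s)
        (A := S.pending r.c e i' i₁ (k + 1) r.ul r.uh) hact01
      rw [← hr] at htight
      refine htight hb2 hb3 (fun ha => ?_) (fun hl => ?_) (fun hh => ?_) hact
      · rw [sact] at ha
        rw [sul, suh]
        refine (h.pend ha).tight.mono ?_
        rintro y ⟨hy, a, h1, h2, h3, h4⟩
        obtain ⟨h5, h6, h7⟩ := hold ha
        have hfit := h.fits ha
        refine ⟨⟨h6.trans hy.1, hy.2.trans h7⟩, a, by rw [hi₁, if_pos ha]; exact h1, by omega,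
          by rw [rc, sc]; exact h3, ?_⟩
        exact (clear_succ h2.le).2 ⟨h4, by linarith [hy.1], by linarith [hy.2]⟩
      · obtain ⟨h1, h2, h3⟩ := hlow hl
        have hmem : ∀ y, S.l k ≤ y → y < r.jl →
            y ∈ S.pending r.c e i' i₁ (k + 1) r.ul r.uh := fun y h4 h5 =>
          hpmem y h4 (by linarith) (Or.inl h5) (by linarith) (by linarith)
        refine ⟨fun z hz => ?_, fun z hz => ⟨_, hmem _ le_rfl hl, hz⟩⟩
        obtain ⟨y, hy1, hy2⟩ := exists_between (max_lt hl hz)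
        rw [max_lt_iff] at hy1
        exact ⟨y, hmem y hy1.1.le hy2, hy1.2⟩
      · obtain ⟨h1, h2, h3⟩ := hhigh hh
        have hmem : ∀ y, y ≤ S.u k → r.jh < y →
            y ∈ S.pending r.c e i' i₁ (k + 1) r.ul r.uh := fun y h4 h5 =>
          hpmem y (by linarith) h4 (Or.inr h5) (by linarith) (by linarith)
        refine ⟨fun z hz => ⟨_, hmem _ le_rfl hh, hz⟩, fun z hz => ?_⟩
        obtain ⟨y, hy1, hy2⟩ := exists_between (lt_min hh hz)
        rw [lt_min_iff] at hy2
        exact ⟨y, hmem y hy2.1.le hy1, hy2.2⟩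
    · rcases h.act01 with ha | ha
      · have hik : i₁ = k := by rw [hi₁, if_neg (by omega)]
        have : ∃ y ∈ S.pending r.c e i' i₁ (k + 1) r.ul r.uh, True := by
          rcases Sweep.act_of_collect (hr ▸ hact) with h1 | h1 | h1
          · rw [sact] at h1; omega
          · rw [← hr] at h1
            obtain ⟨-, h2, h3⟩ := hlow h1
            exact ⟨S.l k, hpmem _ le_rfl hlu.le (Or.inl h1) h2 (by linarith), trivial⟩
          · rw [← hr] at h1
            obtain ⟨-, h2, h3⟩ := hhigh h1
            exact ⟨S.u k, hpmem _ hlu.le le_rfl (Or.inr h1) (by linarith) h3, trivial⟩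
        obtain ⟨y, ⟨hy, a, h1, h2, h3, h4⟩, -⟩ := this
        obtain rfl : a = i₁ := by omega
        exact ⟨y, hy, h3, h4⟩
      · obtain ⟨y, hy, h1, h2⟩ := (h.pend ha).first
        obtain ⟨h5, h6, h7⟩ := hold ha
        have hfit := h.fits ha
        refine ⟨y, ⟨by linarith [hy.1], by linarith [hy.2]⟩, ?_, ?_⟩
        · rw [rc, sc, hi₁, if_pos ha]; exact h1
        · rw [hi₁, if_pos ha]
          exact (clear_succ (h.pend ha).lt.le).2 ⟨h2, by linarith [hy.1], by linarith [hy.2]⟩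
  · intro a ha y hy
    rcases Nat.lt_succ_iff_lt_or_eq.1 ha with ha' | rfl
    · rcases h.cover a ha' y hy with (⟨j, hj, hj'⟩ | ⟨h1, h2, h3, h4, h5⟩) | ⟨h1, h2, h3, h4⟩
      · refine Or.inl (Or.inl ⟨j, by rw [rc, sc]; exact hj, ?_⟩)
        rw [rX, rY, sX, sY j hj]
        exact hj'
      · exact Or.inl (Or.inr ⟨by rw [rc, sc]; exact h1, h2, by omega, h4, h5⟩)
      · obtain ⟨h5, h6, h7⟩ := hold h1
        have hfit := h.fits h1
        refine Or.inr ⟨h5, by rw [hi₁, if_pos h1]; exact h2,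
          ⟨by linarith [h3.1], by linarith [h3.2]⟩, ?_⟩
        exact (clear_succ ha'.le).2 ⟨h4, by linarith [h3.1], by linarith [h3.2]⟩
    · have hcl : S.Clear y a (a + 1) := by
        intro j h6 h7
        obtain rfl : j = a := by omega
        exact hy
      by_cases h1 : y < r.jl
      · obtain ⟨h2, h3, h4⟩ := hlow (by linarith [hy.1])
        exact Or.inr ⟨h2, hi₁k, ⟨by linarith [hy.1], by linarith⟩, hcl⟩
      · by_cases h2 : r.jh < y
        · obtain ⟨h2, h3, h4⟩ := hhigh (by linarith [hy.2])
          exact Or.inr ⟨h2, hi₁k, ⟨by linarith, by linarith [hy.2]⟩, hcl⟩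
        · have hkv : r.kv = 1 := by
            by_contra hkv
            obtain ⟨h3, h4⟩ := hJ0 hkv
            linarith
          have hlast := rgi.last (rgi.valid hkv).1
          refine Or.inl (Or.inr ⟨(rgi.valid hkv).1, by omega, ?_, fun h => by omega, fun _ => ?_⟩)
          · have := hR' (by rw [← rkv]; exact hkv); omega
          · exact (hJ hkv y).1 ⟨not_lt.1 h1, not_lt.1 h2⟩

lemma exists_inv_run (hS : S.Valid) {s₀ : Sweep} (hc : s₀.c = 0) (hkv : s₀.kv = 0)
    (hact : s₀.act = 0) : ∀ k ≤ S.m, ∃ e i' i R, S.Inv (Sweep.run S s₀ k) k e i' i R := by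
  intro k
  induction k with
  | zero =>
    intro _
    rw [Sweep.run]
    refine ⟨0, 0, 0, 0, ⟨Nat.zero_le _, le_rfl, fun _ => rfl, fun h => ?_, fun j h => ?_,
      fun i j _ h => ?_, fun h => ?_, fun _ => Or.inl hc,
      by rw [hc]; exact lowerBound_zero 0⟩, Or.inl hact,
      fun h => ?_, fun h => ?_, fun a h => ?_⟩ <;> omega
  | succ k ih =>
    intro hk
    obtain ⟨e, i', i, R, h⟩ := ih (by omega)
    obtain ⟨e₁, i₁', R₁, h₁⟩ := h.commit hS hk
    obtain ⟨i₂, R₂, h₂⟩ := h₁.step hS hk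
    exact ⟨e₁, i₁', i₂, R₂, h₂⟩

lemma exists_seesRow_of_seen (hS : S.Valid) {s : Sweep} {k e i' R : ℕ} (h : S.GuardInv s k e i' R)
    {a : ℕ} {y : ℝ} (hs : S.Seen s e i' R a y) : ∃ j < s.c, S.SeesRow (s.X j, s.Y j) a y := by
  rcases hs with ⟨j, hj, hs⟩ | ⟨h1, h2, h3, h4, h5⟩
  · exact ⟨j, by omega, hs⟩
  · exact ⟨s.c - 1, by omega, seesRow_last hS h h1 h2 h3 h4 h5⟩

/-- The guards placed by the complete sweep. The initial state `s₀` matters only through `c`, `kv` and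
`act`. -/
noncomputable def sweepGuards (S : Slabs) (s₀ : Sweep) : Sweep :=
  (Sweep.run S s₀ S.m).finish (S.x S.m)

/-- The sweep computes a guard set of minimum cardinality and lists its points without repetition. -/
theorem sweepGuards_spec (hS : S.Valid) {s₀ : Sweep} (hc : s₀.c = 0) (hkv : s₀.kv = 0)
    (hact : s₀.act = 0) :
    IsMinimumGuardSet S.region ((Finset.range (S.sweepGuards s₀).c).image
      fun j => ((S.sweepGuards s₀).X j, (S.sweepGuards s₀).Y j)) ∧
    (S.sweepGuards s₀).c = ((Finset.range (S.sweepGuards s₀).c).image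
      fun j => ((S.sweepGuards s₀).X j, (S.sweepGuards s₀).Y j)).card := by
  obtain ⟨e, i', i, R, h⟩ := exists_inv_run hS hc hkv hact S.m le_rfl
  set s := Sweep.run S s₀ S.m with hs
  have main : (∀ j < (S.sweepGuards s₀).c, ((S.sweepGuards s₀).X j, (S.sweepGuards s₀).Y j) ∈ S.region) ∧
      (∀ i j, i < j → j < (S.sweepGuards s₀).c → (S.sweepGuards s₀).X i < (S.sweepGuards s₀).X j) ∧
      (∀ a < S.m, ∀ y, S.l a ≤ y ∧ y ≤ S.u a →
        ∃ j < (S.sweepGuards s₀).c, S.SeesRow ((S.sweepGuards s₀).X j, (S.sweepGuards s₀).Y j) a y) ∧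
      ∀ H, IsGuardSet S.region H → (S.sweepGuards s₀).c ≤ H.card := by
    by_cases hact : s.act = 1
    · have ht : (S.sweepGuards s₀) = s.place (S.x S.m) := by
        rw [sweepGuards, ← hs, Sweep.finish, if_pos hact]
      obtain ⟨⟨p1, p2, p3, p4⟩, p5, p6, p7, p8⟩ :=
        h.place hS (t := (S.sweepGuards s₀)) hact (by rw [ht]; rfl) (by rw [ht]; rfl) (by rw [ht]; rfl)
      have hlast : ∀ a y, i ≤ a → a < S.m → S.Clear y a S.m →
          S.SeesRow ((S.sweepGuards s₀).X ((S.sweepGuards s₀).c - 1),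
            (S.sweepGuards s₀).Y ((S.sweepGuards s₀).c - 1)) a y := by
        intro a y h1 h2 h3
        rw [p2]
        exact hS.seesRow_left h2 le_rfl (p4.mono h1 le_rfl) h3
      refine ⟨fun j hj => ?_, p6, fun a ha y hy => ?_, fun H hH => ?_⟩
      · by_cases hj' : j + 1 < (S.sweepGuards s₀).c
        · exact p5 j hj'
        · obtain rfl : j = (S.sweepGuards s₀).c - 1 := by omega
          rw [p2]
          obtain ⟨q, hq⟩ : ∃ q, S.m = q + 1 := ⟨S.m - 1, by have := hS.pos; omega⟩
          refine ⟨q, by omega, ⟨?_, by rw [← hq]⟩, p4 q (by omega) (by omega)⟩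
          rw [hq]
          exact (hS.x_lt q (by omega)).le
      · rcases p8 a ha y hy with ⟨j, hj, hj'⟩ | ⟨h1, h2, h3, h4, -⟩
        · exact ⟨j, by omega, hj'⟩
        · exact ⟨_, by omega, hlast a y h2 ha (h4 ha)⟩
      · have hp := h.pend hact
        obtain ⟨y, -, hy, -⟩ := hp.first
        rw [ht]
        exact h.guards.lower.succ_le hS hp.lt hy hH
    · have ht : (S.sweepGuards s₀) = s := by rw [sweepGuards, ← hs, Sweep.finish, if_neg hact]
      rw [ht]
      refine ⟨fun j hj => ?_, h.guards.strict, fun a ha y hy => ?_,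
        fun H hH => (h.guards.lower H hH).1⟩
      · by_cases hj' : j + 1 < s.c
        · exact h.guards.mem j hj'
        · obtain rfl : j = s.c - 1 := by omega
          exact mem_region_last hS h.guards (by omega)
      · rcases h.cover a ha y hy with h1 | h1
        · exact exists_seesRow_of_seen hS h.guards h1
        · exact absurd h1.1 hact
  obtain ⟨hmem, hstrict, hsee, hlow⟩ := main
  have hcard : ((Finset.range (S.sweepGuards s₀).c).image
      fun j => ((S.sweepGuards s₀).X j, (S.sweepGuards s₀).Y j)).card = (S.sweepGuards s₀).c := by
    rw [Finset.card_image_of_injOn, Finset.card_range]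
    intro a ha b hb hab
    have hX : (S.sweepGuards s₀).X a = (S.sweepGuards s₀).X b := congrArg Prod.fst hab
    rw [Finset.mem_coe, Finset.mem_range] at ha hb
    rcases lt_trichotomy a b with hlt | hlt | hlt
    · exact absurd hX (hstrict a b hlt hb).ne
    · exact hlt
    · exact absurd hX (hstrict b a hlt ha).ne'
  refine ⟨⟨⟨fun g hg => ?_, ?_⟩, fun H hH => by rw [hcard]; exact hlow H hH⟩, hcard.symm⟩
  · obtain ⟨j, hj, rfl⟩ := Finset.mem_image.1 hg
    exact hmem j (Finset.mem_range.1 hj)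
  · rintro ⟨z, y⟩ ⟨a, ha, hz, hy⟩
    obtain ⟨j, hj, hsj⟩ := hsee a ha y hy
    exact ⟨_, Finset.mem_image_of_mem _ (Finset.mem_range.2 hj), hsj z hz.1 hz.2⟩

end Slabs

/-! ### The region between two chains -/

/-- A set that is a neighbourhood of each of its points off `∂`, that contains `∂` and whose
vertical sections are order connected is the region bounded by `∂`. -/
lemma bounded_components_eq {R bd : Set (ℝ × ℝ)} (hR : Bornology.IsBounded R) (hcl : IsClosed R)
    (hbd : bd ⊆ R) (hint : ∀ p ∈ R, p ∉ bd → p ∈ interior R)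
    (hcol : ∀ z w₁ w₂ w₃ : ℝ, (z, w₁) ∈ R → (z, w₃) ∈ R → w₁ ≤ w₂ → w₂ ≤ w₃ → (z, w₂) ∈ R) :
    bd ∪ {p | p ∉ bd ∧ Bornology.IsBounded (connectedComponentIn bdᶜ p)} = R := by
  apply Subset.antisymm
  · rintro ⟨z, w⟩ (hp | ⟨hp, hb⟩)
    · exact hbd hp
    · by_contra hpR
      -- One of the two vertical rays from the point avoids `R`.
      have hray : ∀ T : Set ℝ, IsPreconnected T → w ∈ T → (∀ w' ∈ T, (z, w') ∉ R) →
          Bornology.IsBounded T := by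
        intro T hT hwT hTR
        have h1 : IsPreconnected ((fun w' => (z, w')) '' T) :=
          hT.image _ (Continuous.continuousOn (by fun_prop))
        have h2 : ((fun w' => (z, w')) '' T) ⊆ connectedComponentIn bdᶜ (z, w) := by
          refine h1.subset_connectedComponentIn ⟨w, hwT, rfl⟩ ?_
          rintro _ ⟨w', hw', rfl⟩ h
          exact hTR w' hw' (hbd h)
        have h3 := (hb.subset h2).image_snd
        rwa [image_image, image_id'] at h3
      by_cases hup : ∃ w' ∈ Ici w, (z, w') ∈ R
      · obtain ⟨w₃, hw₃, h₃⟩ := hup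
        have := hray (Iic w) isPreconnected_Iic self_mem_Iic fun w₁ hw₁ h₁ =>
          hpR (hcol z w₁ w w₃ h₁ h₃ hw₁ hw₃)
        exact not_bddBelow_Iic w this.bddBelow
      · push Not at hup
        have := hray (Ici w) isPreconnected_Ici self_mem_Ici hup
        exact not_bddAbove_Ici w this.bddAbove
  · intro p hp
    by_cases hpb : p ∈ bd
    · exact Or.inl hpb
    · refine Or.inr ⟨hpb, hR.subset ?_⟩
      have hsub : connectedComponentIn bdᶜ p ⊆ interior R ∪ Rᶜ := by
        intro q hq
        by_cases hqR : q ∈ R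
        · exact Or.inl (hint q hqR (connectedComponentIn_subset _ _ hq))
        · exact Or.inr hqR
      exact (isPreconnected_connectedComponentIn.subset_left_of_subset_union isOpen_interior
        hcl.isOpen_compl (disjoint_compl_right.mono_left interior_subset) hsub
        ⟨p, mem_connectedComponentIn hpb, hint p hp hpb⟩).trans interior_subset

lemma lt_or_lt_of_disjoint_uIcc {f f' b b' : ℝ} (h : Disjoint (uIcc f f') (uIcc b b')) :
    max f f' < min b b' ∨ max b b' < min f f' := by
  by_contra! hc
  -- The larger of the two lower ends is a common point.
  have h1 : max (min f f') (min b b') ∈ uIcc f f' :=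
    ⟨le_max_left _ _, max_le min_le_max hc.1⟩
  have h2 : max (min f f') (min b b') ∈ uIcc b b' :=
    ⟨le_max_right _ _, max_le hc.2 min_le_max⟩
  exact disjoint_left.1 h h1 h2

/-- A chain of horizontal edges `[p a, p (a + 1)] × {α a}`, `a < A`, connected by vertical edges. -/
def chain (A : ℕ) (p α : ℕ → ℝ) : Set (ℝ × ℝ) :=
  {z | ∃ a < A, (p a ≤ z.1 ∧ z.1 ≤ p (a + 1)) ∧ z.2 = α a} ∪
  {z | ∃ a, a + 1 < A ∧ z.1 = p (a + 1) ∧ z.2 ∈ uIcc (α a) (α (a + 1))}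

/-- Two disjoint chains over the same interval, and the vertical edges at its ends. -/
structure ChainPair (A B : ℕ) (p q α β : ℕ → ℝ) : Prop where
  posA : 0 < A
  posB : 0 < B
  p_lt : ∀ a < A, p a < p (a + 1)
  q_lt : ∀ b < B, q b < q (b + 1)
  left : p 0 = q 0
  right : p A = q B
  disj : Disjoint (chain A p α) (chain B q β)

/-- The closed curve formed by two chains and the vertical edges at their ends. -/
def chainBoundary (A B : ℕ) (p q α β : ℕ → ℝ) : Set (ℝ × ℝ) :=
  chain A p α ∪ chain B q β ∪ {z | z.1 = p 0 ∧ z.2 ∈ uIcc (α 0) (β 0)} ∪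
    {z | z.1 = p A ∧ z.2 ∈ uIcc (α (A - 1)) (β (B - 1))}

/-- The `m` slabs between breakpoints `x` that arise by merging the breakpoints `p` and `q` of two
chains: slab `k` lies on edge `a k` of the first and on edge `b k` of the second chain. -/
structure IsMerge (A B : ℕ) (p q : ℕ → ℝ) (a b : ℕ → ℕ) (x : ℕ → ℝ) (m : ℕ) : Prop where
  pos : 0 < m
  a_zero : a 0 = 0
  b_zero : b 0 = 0
  x_zero : x 0 = p 0
  lt : ∀ k < m, a k < A ∧ b k < B
  x_succ : ∀ k < m, x (k + 1) = min (p (a k + 1)) (q (b k + 1))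
  a_adv : ∀ k < m, x (k + 1) = p (a k + 1) → a (k + 1) = a k + 1
  a_stay : ∀ k < m, x (k + 1) ≠ p (a k + 1) → a (k + 1) = a k
  b_adv : ∀ k < m, x (k + 1) = q (b k + 1) → b (k + 1) = b k + 1
  b_stay : ∀ k < m, x (k + 1) ≠ q (b k + 1) → b (k + 1) = b k
  a_end : a m = A
  b_end : b m = B

section Merge

variable {A B : ℕ} {p q α β : ℕ → ℝ} {a b : ℕ → ℕ} {x : ℕ → ℝ} {m : ℕ}

lemma ChainPair.symm (h : ChainPair A B p q α β) : ChainPair B A q p β α :=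
  ⟨h.posB, h.posA, h.q_lt, h.p_lt, h.left.symm, h.right.symm, h.disj.symm⟩

lemma IsMerge.symm (h : ChainPair A B p q α β) (hm : IsMerge A B p q a b x m) :
    IsMerge B A q p b a x m :=
  ⟨hm.pos, hm.b_zero, hm.a_zero, hm.x_zero.trans h.left, fun k hk => (hm.lt k hk).symm,
    fun k hk => by rw [hm.x_succ k hk, min_comm], hm.b_adv, hm.b_stay, hm.a_adv, hm.a_stay,
    hm.b_end, hm.a_end⟩

/-- The slabs between two chains. -/
noncomputable def mergeSlabs (α β : ℕ → ℝ) (a b : ℕ → ℕ) (x : ℕ → ℝ) (m : ℕ) : Slabs where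
  m := m
  x := x
  l k := min (α (a k)) (β (b k))
  u k := max (α (a k)) (β (b k))

namespace IsMerge

variable (hm : IsMerge A B p q a b x m) (h : ChainPair A B p q α β)
include hm h

/-- Slab `k` lies on the edges `a k` and `b k`. -/
lemma range : ∀ k < m, (p (a k) ≤ x k ∧ x k < p (a k + 1)) ∧ (q (b k) ≤ x k ∧ x k < q (b k + 1)) := by
  intro k
  induction k with
  | zero =>
    intro _
    rw [hm.a_zero, hm.b_zero]
    have e := hm.x_zero
    have e' := h.left
    have h1 := h.p_lt 0 h.posA
    have h2 := h.q_lt 0 h.posB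
    exact ⟨⟨e.ge, e ▸ h1⟩, ⟨(e.trans e').ge, (e.trans e') ▸ h2⟩⟩
  | succ k ih =>
    intro hk
    obtain ⟨⟨h1, h2⟩, h3, h4⟩ := ih (by omega)
    have hx := hm.x_succ k (by omega)
    have hlt := hm.lt (k + 1) hk
    have hxk : x k < x (k + 1) := by rw [hx]; exact lt_min h2 h4
    constructor
    · by_cases hp : x (k + 1) = p (a k + 1)
      · have e := hm.a_adv k (by omega) hp
        rw [e] at hlt ⊢
        exact ⟨hp.ge, hp ▸ h.p_lt _ hlt.1⟩
      · have e := hm.a_stay k (by omega) hp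
        rw [e]
        exact ⟨h1.trans hxk.le, lt_of_le_of_ne (hx ▸ min_le_left _ _) hp⟩
    · by_cases hp : x (k + 1) = q (b k + 1)
      · have e := hm.b_adv k (by omega) hp
        rw [e] at hlt ⊢
        exact ⟨hp.ge, hp ▸ h.q_lt _ hlt.2⟩
      · have e := hm.b_stay k (by omega) hp
        rw [e]
        exact ⟨h3.trans hxk.le, lt_of_le_of_ne (hx ▸ min_le_right _ _) hp⟩

lemma x_lt : ∀ k < m, x k < x (k + 1) := by
  intro k hk
  have := hm.range h k hk
  rw [hm.x_succ k hk]
  exact lt_min this.1.2 this.2.2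

lemma horizontal_mem {k : ℕ} (hk : k < m) {z : ℝ} (h1 : x k ≤ z) (h2 : z ≤ x (k + 1)) :
    (z, α (a k)) ∈ chain A p α := by
  refine Or.inl ⟨a k, (hm.lt k hk).1, ⟨(hm.range h k hk).1.1.trans h1, h2.trans ?_⟩, rfl⟩
  rw [hm.x_succ k hk]
  exact min_le_left _ _

lemma vertical_mem {k : ℕ} (hk : k + 1 < m) {w : ℝ} (hw : w ∈ uIcc (α (a k)) (α (a (k + 1)))) :
    (x (k + 1), w) ∈ chain A p α := by
  by_cases hp : x (k + 1) = p (a k + 1)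
  · have e := hm.a_adv k (by omega) hp
    rw [e] at hw
    exact Or.inr ⟨a k, by have := (hm.lt _ hk).1; omega, hp, hw⟩
  · have e := hm.a_stay k (by omega) hp
    rw [e, uIcc_self] at hw
    rw [hw]
    exact hm.horizontal_mem h (by omega) (hm.x_lt h k (by omega)).le le_rfl

omit h in
/-- Each edge of the chain is left at some breakpoint. -/
lemma exists_adv {i : ℕ} (hi : i < A) : ∃ k < m, a k = i ∧ a (k + 1) = i + 1 ∧ x (k + 1) = p (i + 1) := by
  have hex : ∃ k, i < a k := ⟨m, by rw [hm.a_end]; exact hi⟩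
  classical
  have h1 := Nat.find_spec hex
  have h2 : Nat.find hex ≤ m := Nat.find_min' hex (by rw [hm.a_end]; exact hi)
  obtain ⟨k, hk⟩ : ∃ k, Nat.find hex = k + 1 := by
    refine Nat.exists_eq_succ_of_ne_zero fun h0 => ?_
    rw [h0, hm.a_zero] at h1
    omega
  have h3 : ¬ i < a k := Nat.find_min hex (by omega)
  rw [hk] at h1
  have hkm : k < m := by omega
  by_cases hp : x (k + 1) = p (a k + 1)
  · have e := hm.a_adv k hkm hp
    have : a k = i := by omega
    exact ⟨k, hkm, this, by omega, by rw [hp, this]⟩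
  · have e := hm.a_stay k hkm hp
    omega

lemma edge_last : a (m - 1) = A - 1 ∧ x m = p A := by
  obtain ⟨k, hk, h1, h2, h3⟩ := hm.exists_adv (i := A - 1) (by have := h.posA; omega)
  have hA : A - 1 + 1 = A := Nat.sub_add_cancel h.posA
  rw [hA] at h2 h3
  have : k + 1 = m := by
    by_contra hne
    have := (hm.lt (k + 1) (by omega)).1
    omega
  have hk' : k = m - 1 := by omega
  rw [← hk', ← this]
  exact ⟨h1, h3⟩

/-- The steps of the two chains at a breakpoint are disjoint; the step of a chain that has no vertical
edge there is a point. -/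
lemma disjoint_verticals {k : ℕ} (hk : k + 1 < m) :
    Disjoint (uIcc (α (a k)) (α (a (k + 1)))) (uIcc (β (b k)) (β (b (k + 1)))) := by
  rw [disjoint_left]
  intro w h1 h2
  exact disjoint_left.1 h.disj (hm.vertical_mem h hk h1) ((hm.symm h).vertical_mem h.symm hk h2)

lemma ne {k : ℕ} (hk : k < m) : α (a k) ≠ β (b k) := by
  intro e
  have h1 := hm.horizontal_mem h hk le_rfl (hm.x_lt h k hk).le
  have h2 := (hm.symm h).horizontal_mem h.symm hk le_rfl (hm.x_lt h k hk).le
  rw [e] at h1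
  exact disjoint_left.1 h.disj h1 h2

lemma valid : (mergeSlabs α β a b x m).Valid :=
  ⟨hm.pos, hm.x_lt h, fun _ hk => min_lt_max.2 (hm.ne h hk)⟩

omit hm h in
lemma mem_region_iff {z w : ℝ} : (z, w) ∈ (mergeSlabs α β a b x m).region ↔
    ∃ k < m, (x k ≤ z ∧ z ≤ x (k + 1)) ∧ w ∈ uIcc (α (a k)) (β (b k)) := Iff.rfl

omit hm h in
lemma region_symm : (mergeSlabs β α b a x m).region = (mergeSlabs α β a b x m).region := by
  ext ⟨z, w⟩
  simp only [mem_region_iff, uIcc_comm]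

lemma chain_subset : chain A p α ⊆ (mergeSlabs α β a b x m).region := by
  rintro ⟨z, w⟩ (⟨i, hi, hz, hw⟩ | ⟨i, hi, hz, hw⟩)
  · obtain ⟨k₂, hk₂, h1, h2, h3⟩ := hm.exists_adv hi
    -- The slabs on edge `i` are those from `k₁` to `k₂`.
    obtain ⟨k₁, hk₁, hx, hak⟩ : ∃ k₁ ≤ k₂, x k₁ = p i ∧ ∀ k, k₁ ≤ k → k ≤ k₂ → a k = i := by
      have hmono : ∀ k l, k ≤ l → l ≤ m → a k ≤ a l := by
        intro k l hkl
        induction l, hkl using Nat.le_induction with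
        | base => exact fun _ => le_rfl
        | succ l hkl ih =>
          intro hl
          refine (ih (by omega)).trans ?_
          by_cases hp : x (l + 1) = p (a l + 1)
          · exact (hm.a_adv l hl hp).symm ▸ Nat.le_succ _
          · exact (hm.a_stay l hl hp).ge
      rcases i with _ | i
      · refine ⟨0, Nat.zero_le _, hm.x_zero, fun k _ hk => ?_⟩
        have := hmono k k₂ hk hk₂.le
        omega
      · obtain ⟨k₁, hk₁, e1, e2, e3⟩ := hm.exists_adv (i := i) (by omega)
        refine ⟨k₁ + 1, ?_, e3, fun k hk hk' => ?_⟩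
        · by_contra hlt
          have := hmono (k₂ + 1) (k₁ + 1) (by omega) (by omega)
          omega
        · have := hmono (k₁ + 1) k hk (by omega)
          have := hmono k k₂ hk' hk₂.le
          omega
    obtain ⟨k, e1, e2, e3⟩ := exists_slab_of_mem (x := x) (i := k₁) (j := k₂ + 1) (by omega)
      (hx ▸ hz.1) (h3 ▸ hz.2)
    refine ⟨k, by change k < m; omega, e3, ?_⟩
    change w = α i at hw
    rw [hw, ← hak k e1 (by omega)]
    exact ⟨min_le_left _ _, le_max_left _ _⟩
  · obtain ⟨k, hk, h1, h2, h3⟩ := hm.exists_adv (i := i) (by omega)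
    have hk' : k + 1 < m := by
      by_contra hne
      have : k + 1 = m := by omega
      rw [this, hm.a_end] at h2
      omega
    have hd := lt_or_lt_of_disjoint_uIcc (hm.disjoint_verticals h hk')
    have hxk := hm.x_lt h k hk
    have hxk' := hm.x_lt h (k + 1) hk'
    have e2 : a (k + 1) = a k + 1 := by omega
    rw [← h1, ← e2] at hw
    change z = p (i + 1) at hz
    change w ∈ _ at hw
    rw [mem_region_iff, hz, ← h3]
    simp only [uIcc, mem_Icc, inf_le_iff, le_sup_iff, max_lt_iff, lt_min_iff] at hd hw ⊢
    by_cases hw' : w ∈ uIcc (α (a k)) (β (b k))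
    · exact ⟨k, hk, ⟨hxk.le, le_rfl⟩, by simpa [uIcc] using hw'⟩
    · refine ⟨k + 1, hk', ⟨le_rfl, hxk'.le⟩, ?_⟩
      simp only [uIcc, mem_Icc, inf_le_iff, le_sup_iff] at hw'
      grind

/-- Consecutive slabs have a common level. -/
lemma window {k : ℕ} (hk : k + 1 < m) :
    ∃ w, w ∈ uIcc (α (a k)) (β (b k)) ∧ w ∈ uIcc (α (a (k + 1))) (β (b (k + 1))) := by
  rcases lt_or_lt_of_disjoint_uIcc (hm.disjoint_verticals h hk) with hd | hd
  · refine ⟨max (α (a k)) (α (a (k + 1))), ?_, ?_⟩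
    all_goals
      simp only [uIcc, mem_Icc, inf_le_iff, le_sup_iff, max_lt_iff, lt_min_iff,
        max_le_iff] at hd ⊢
      grind
  · refine ⟨max (β (b k)) (β (b (k + 1))), ?_, ?_⟩
    all_goals
      simp only [uIcc, mem_Icc, inf_le_iff, le_sup_iff, max_lt_iff, lt_min_iff,
        max_le_iff] at hd ⊢
      grind

/-- The vertical sections of the union of the slabs are order connected. -/
lemma column {z w₁ w₂ w₃ : ℝ} (h1 : (z, w₁) ∈ (mergeSlabs α β a b x m).region)
    (h3 : (z, w₃) ∈ (mergeSlabs α β a b x m).region) (h12 : w₁ ≤ w₂) (h23 : w₂ ≤ w₃) :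
    (z, w₂) ∈ (mergeSlabs α β a b x m).region := by
  have key : ∀ k l, k < m → l < m → k < l → z ≤ x (k + 1) → x l ≤ z → l = k + 1 := by
    intro k l hk hl hkl e1 e2
    by_contra hne
    have := (hm.valid h).x_lt_of_lt (i := k + 1) (j := l) (by omega) hl.le
    change x (k + 1) < x l at this
    linarith
  rw [mem_region_iff] at *
  obtain ⟨k, hk, hz, hw⟩ := h1
  obtain ⟨l, hl, hz', hw'⟩ := h3
  rcases lt_trichotomy k l with hkl | rfl | hkl
  · obtain rfl := key k l hk hl hkl hz.2 hz'.1
    obtain ⟨v, hv, hv'⟩ := hm.window h hl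
    rcases le_total w₂ v with e | e
    · exact ⟨k, hk, hz, ordConnected_uIcc.out hw hv ⟨h12, e⟩⟩
    · exact ⟨k + 1, hl, hz', ordConnected_uIcc.out hv' hw' ⟨e, h23⟩⟩
  · exact ⟨k, hk, hz, ordConnected_uIcc.out hw hw' ⟨h12, h23⟩⟩
  · obtain rfl := key l k hl hk hkl hz'.2 hz.1
    obtain ⟨v, hv, hv'⟩ := hm.window h hk
    rcases le_total w₂ v with e | e
    · exact ⟨l + 1, hk, hz, ordConnected_uIcc.out hw hv' ⟨h12, e⟩⟩
    · exact ⟨l, hl, hz', ordConnected_uIcc.out hv hw' ⟨e, h23⟩⟩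

omit hm h in
lemma region_eq_iUnion : (mergeSlabs α β a b x m).region =
    ⋃ k ∈ Finset.range m, Icc (x k) (x (k + 1)) ×ˢ uIcc (α (a k)) (β (b k)) := by
  ext ⟨z, w⟩
  simp only [mem_region_iff, mem_iUnion, Finset.mem_range, exists_prop, mem_prod, mem_Icc]

omit hm h in
lemma isCompact_region : IsCompact (mergeSlabs α β a b x m).region := by
  rw [region_eq_iUnion]
  exact (Finset.range m).isCompact_biUnion fun k _ => isCompact_Icc.prod isCompact_uIcc

/-- The boundary curve contains the frontier of the union of the slabs. -/
lemma mem_interior {z w : ℝ} (hz : (z, w) ∈ (mergeSlabs α β a b x m).region)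
    (hbd : (z, w) ∉ chainBoundary A B p q α β) :
    (z, w) ∈ interior (mergeSlabs α β a b x m).region := by
  simp only [chainBoundary, mem_union, not_or] at hbd
  obtain ⟨⟨⟨hA, hB⟩, hL⟩, hR⟩ := hbd
  -- At an inner breakpoint, a point off the vertical edges is inside both slabs or neither.
  have inner : ∀ k, k + 1 < m → z = x (k + 1) →
      (min (α (a k)) (β (b k)) < w ∧ w < max (α (a k)) (β (b k)) ∨
        min (α (a (k + 1))) (β (b (k + 1))) < w ∧ w < max (α (a (k + 1))) (β (b (k + 1)))) →
      (z, w) ∈ interior (mergeSlabs α β a b x m).region := by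
    intro k hk hzk hw
    have h1 : w ∉ uIcc (α (a k)) (α (a (k + 1))) := fun h' => hA (hzk ▸ hm.vertical_mem h hk h')
    have h2 : w ∉ uIcc (β (b k)) (β (b (k + 1))) := fun h' =>
      hB (hzk ▸ (hm.symm h).vertical_mem h.symm hk h')
    have hd := lt_or_lt_of_disjoint_uIcc (hm.disjoint_verticals h hk)
    have hw2 : (min (α (a k)) (β (b k)) < w ∧ w < max (α (a k)) (β (b k))) ∧
        min (α (a (k + 1))) (β (b (k + 1))) < w ∧ w < max (α (a (k + 1))) (β (b (k + 1))) := by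
      simp only [uIcc, mem_Icc, inf_le_iff, le_sup_iff, max_lt_iff, lt_min_iff, min_lt_iff,
        lt_max_iff] at *
      grind
    refine _root_.mem_interior.2 ⟨Ioo (x k) (x (k + 2)) ×ˢ
      (Ioo (min (α (a k)) (β (b k))) (max (α (a k)) (β (b k))) ∩
        Ioo (min (α (a (k + 1))) (β (b (k + 1)))) (max (α (a (k + 1))) (β (b (k + 1))))), ?_,
      isOpen_Ioo.prod (isOpen_Ioo.inter isOpen_Ioo), ⟨?_, hw2.1, hw2.2⟩⟩
    · rintro ⟨z', w'⟩ ⟨hz', hw1, hw2⟩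
      rcases le_total z' (x (k + 1)) with e | e
      · exact ⟨k, (by omega : k < m), ⟨hz'.1.le, e⟩, hw1.1.le, hw1.2.le⟩
      · exact ⟨k + 1, hk, ⟨e, hz'.2.le⟩, hw2.1.le, hw2.2.le⟩
    · exact hzk ▸ ⟨hm.x_lt h k (by omega), hm.x_lt h (k + 1) hk⟩
  obtain ⟨k, hk, hz, hw⟩ := mem_region_iff.1 hz
  have hw1 : w ≠ α (a k) := fun e => hA (e ▸ hm.horizontal_mem h hk hz.1 hz.2)
  have hw2 : w ≠ β (b k) := fun e => hB (e ▸ (hm.symm h).horizontal_mem h.symm hk hz.1 hz.2)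
  have hw3 : min (α (a k)) (β (b k)) < w ∧ w < max (α (a k)) (β (b k)) := by
    simp only [uIcc, mem_Icc, inf_le_iff, le_sup_iff, min_lt_iff, lt_max_iff] at *
    grind
  rcases hz.1.eq_or_lt with e1 | e1
  · rcases k with _ | k
    · rw [hm.a_zero, hm.b_zero] at hw
      exact absurd ⟨e1.symm.trans hm.x_zero, hw⟩ hL
    · exact inner k hk e1.symm (Or.inr hw3)
  · rcases hz.2.eq_or_lt with e2 | e2
    · by_cases hk' : k + 1 < m
      · exact inner k hk' e2 (Or.inl hw3)
      · have hkm : k = m - 1 := by omega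
        have h1 := hm.edge_last h
        have h2 := (hm.symm h).edge_last h.symm
        rw [hkm, h1.1, h2.1] at hw
        refine absurd ⟨?_, hw⟩ hR
        rw [← h1.2, show m = k + 1 by omega]
        exact e2
    · refine _root_.mem_interior.2 ⟨Ioo (x k) (x (k + 1)) ×ˢ
        Ioo (min (α (a k)) (β (b k))) (max (α (a k)) (β (b k))), ?_,
        isOpen_Ioo.prod isOpen_Ioo, ⟨⟨e1, e2⟩, hw3⟩⟩
      rintro ⟨z', w'⟩ ⟨hz', hw'⟩
      exact ⟨k, hk, ⟨hz'.1.le, hz'.2.le⟩, hw'.1.le, hw'.2.le⟩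

/-- The region bounded by two chains is the union of the slabs between them. -/
theorem region_eq : chainBoundary A B p q α β ∪ {z | z ∉ chainBoundary A B p q α β ∧
      Bornology.IsBounded (connectedComponentIn (chainBoundary A B p q α β)ᶜ z)} =
    (mergeSlabs α β a b x m).region := by
  refine bounded_components_eq isCompact_region.isBounded isCompact_region.isClosed ?_
    (fun z hz hbd => hm.mem_interior h hz hbd) fun z w₁ w₂ w₃ => hm.column h
  rintro ⟨z, w⟩ (((hz | hz) | ⟨hz, hw⟩) | ⟨hz, hw⟩)
  · exact hm.chain_subset h hz
  · rw [← region_symm]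
    exact (hm.symm h).chain_subset h.symm hz
  · change z = p 0 at hz
    refine mem_region_iff.2 ⟨0, hm.pos, ?_, ?_⟩
    · rw [hz, hm.x_zero]
      exact ⟨le_rfl, hm.x_zero ▸ (hm.x_lt h 0 hm.pos).le⟩
    · rw [hm.a_zero, hm.b_zero]; exact hw
  · change z = p A at hz
    have h1 := hm.edge_last h
    have h2 := (hm.symm h).edge_last h.symm
    have hmp := hm.pos
    refine mem_region_iff.2 ⟨m - 1, by omega, ?_, ?_⟩
    · have := hm.x_lt h (m - 1) (by omega)
      rw [Nat.sub_add_cancel hmp] at this ⊢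
      rw [hz, ← h1.2]
      exact ⟨this.le, le_rfl⟩
    · rw [h1.1, h2.1]; exact hw

end IsMerge

end Merge

/-! ### Merging the breakpoints of two chains -/

section Merge

variable {A B : ℕ} {p q α β : ℕ → ℝ}

open Classical in
/-- The pairs of edges, one of each chain, on which the successive slabs lie. -/
noncomputable def mergeIdx (p q : ℕ → ℝ) : ℕ → ℕ × ℕ
  | 0 => (0, 0)
  | k + 1 =>
    let a := (mergeIdx p q k).1
    let b := (mergeIdx p q k).2
    (if q (b + 1) < p (a + 1) then a else a + 1, if p (a + 1) < q (b + 1) then b else b + 1)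

/-- The breakpoints of both chains in increasing order. -/
noncomputable def mergeX (p q : ℕ → ℝ) : ℕ → ℝ
  | 0 => p 0
  | k + 1 => min (p ((mergeIdx p q k).1 + 1)) (q ((mergeIdx p q k).2 + 1))

lemma mergeIdx_add_lt (k : ℕ) :
    (mergeIdx p q k).1 + (mergeIdx p q k).2 < (mergeIdx p q (k + 1)).1 + (mergeIdx p q (k + 1)).2 := by
  simp only [mergeIdx]
  split_ifs with h1 h2 <;> first | omega | exact absurd h1 h2.not_gt

lemma le_mergeIdx_add (k : ℕ) : k ≤ (mergeIdx p q k).1 + (mergeIdx p q k).2 := by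
  induction k with
  | zero => exact Nat.zero_le _
  | succ k ih => have := mergeIdx_add_lt (p := p) (q := q) k; omega

lemma le_of_forall_lt_succ {A : ℕ} {p : ℕ → ℝ} (hp : ∀ a < A, p a < p (a + 1)) {i j : ℕ}
    (hij : i ≤ j) (hj : j ≤ A) : p i ≤ p j := by
  induction j, hij using Nat.le_induction with
  | base => exact le_rfl
  | succ j hij ih => exact (ih (by omega)).trans (hp j (by omega)).le

/-- Both chains end at the same breakpoint, so that merging stops at the end of both. -/
lemma ChainPair.exists_isMerge (h : ChainPair A B p q α β) :
    ∃ m ≤ A + B, IsMerge A B p q (fun k => (mergeIdx p q k).1) (fun k => (mergeIdx p q k).2)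
      (mergeX p q) m := by
  classical
  have hex : ∃ k, ¬((mergeIdx p q k).1 < A ∧ (mergeIdx p q k).2 < B) :=
    ⟨A + B, fun hlt => by have := le_mergeIdx_add (p := p) (q := q) (A + B); omega⟩
  obtain ⟨m, hm⟩ : ∃ m, Nat.find hex = m + 1 := by
    refine Nat.exists_eq_succ_of_ne_zero fun h0 => ?_
    have := Nat.find_spec hex
    rw [h0] at this
    exact this ⟨h.posA, h.posB⟩
  have hlt : ∀ k < m + 1, (mergeIdx p q k).1 < A ∧ (mergeIdx p q k).2 < B := fun k hk =>
    not_not.1 (Nat.find_min hex (hm ▸ hk))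
  have hend : (mergeIdx p q (m + 1)).1 = A ∧ (mergeIdx p q (m + 1)).2 = B := by
    have h1 := Nat.find_spec hex
    rw [hm] at h1
    obtain ⟨hA, hB⟩ := hlt m (Nat.lt_succ_self m)
    have hr := h.right
    have pA : p ((mergeIdx p q m).1 + 1) ≤ p A := le_of_forall_lt_succ h.p_lt hA le_rfl
    have qB : q ((mergeIdx p q m).2 + 1) ≤ q B := le_of_forall_lt_succ h.q_lt hB le_rfl
    have pA' : (mergeIdx p q m).1 + 1 < A → p ((mergeIdx p q m).1 + 1) < p A := fun h' =>
      (h.p_lt _ h').trans_le (le_of_forall_lt_succ h.p_lt h' le_rfl)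
    have qB' : (mergeIdx p q m).2 + 1 < B → q ((mergeIdx p q m).2 + 1) < q B := fun h' =>
      (h.q_lt _ h').trans_le (le_of_forall_lt_succ h.q_lt h' le_rfl)
    have eA : (mergeIdx p q m).1 + 1 < A ∨ (mergeIdx p q m).1 + 1 = A := by omega
    have eB : (mergeIdx p q m).2 + 1 < B ∨ (mergeIdx p q m).2 + 1 = B := by omega
    simp only [mergeIdx] at h1 ⊢
    rcases eA with eA | eA <;> rcases eB with eB | eB
    · exfalso
      refine h1 ⟨?_, ?_⟩ <;> split_ifs <;> omega
    · have := pA' eA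
      rw [eB] at h1 ⊢
      rw [if_pos (by linarith : p ((mergeIdx p q m).1 + 1) < q B)] at h1
      exfalso
      refine h1 ⟨?_, hB⟩
      split_ifs <;> omega
    · have := qB' eB
      rw [eA] at h1 ⊢
      rw [if_pos (by linarith : q ((mergeIdx p q m).2 + 1) < p A)] at h1
      exfalso
      refine h1 ⟨hA, ?_⟩
      split_ifs <;> omega
    · rw [eA, eB, if_neg (by linarith), if_neg (by linarith)]
      exact ⟨rfl, rfl⟩
  refine ⟨m + 1, ?_, Nat.succ_pos m, rfl, rfl, rfl, hlt, fun _ _ => rfl, ?_, ?_, ?_, ?_,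
    hend.1, hend.2⟩
  · have := le_mergeIdx_add (p := p) (q := q) (m + 1)
    omega
  all_goals
    intro k _
    simp only [mergeX, mergeIdx]
    intro hx
    split_ifs with h1
    all_goals first | rfl | skip
  · rw [min_eq_right h1.le] at hx; linarith
  · exact absurd (min_eq_left (not_lt.1 h1)) hx
  · rw [min_eq_left h1.le] at hx; linarith
  · exact absurd (min_eq_right (not_lt.1 h1)) hx

end Merge

lemma mem_affineSegment_of_snd_eq {u v z : ℝ × ℝ} (h : u.2 = v.2) :
    z ∈ affineSegment ℝ u v ↔ z.1 ∈ uIcc u.1 v.1 ∧ z.2 = u.2 := by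
  obtain ⟨u1, u2⟩ := u
  obtain ⟨v1, v2⟩ := v
  obtain rfl : u2 = v2 := h
  rw [affineSegment_eq_segment, ← Prod.image_mk_segment_left, segment_eq_uIcc]
  obtain ⟨z1, z2⟩ := z
  simp [eq_comm]

lemma mem_affineSegment_of_fst_eq {u v z : ℝ × ℝ} (h : u.1 = v.1) :
    z ∈ affineSegment ℝ u v ↔ z.1 = u.1 ∧ z.2 ∈ uIcc u.2 v.2 := by
  obtain ⟨u1, u2⟩ := u
  obtain ⟨v1, v2⟩ := v
  obtain rfl : u1 = v1 := h
  rw [affineSegment_eq_segment, ← Prod.image_mk_segment_right, segment_eq_uIcc]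
  obtain ⟨z1, z2⟩ := z
  simp [eq_comm, and_comm]

/-- The properties of the periodic sequence of vertices of a simple orthogonal `x`-monotone polygon
that determine its shape. -/
structure Circuit (n : ℕ) (w : ℕ → ℝ × ℝ) : Prop where
  pos : 0 < n
  per : ∀ i, w (i + n) = w i
  ne : ∀ i, w i ≠ w (i + 1)
  alt : ∀ i, ((w i).2 = (w (i + 1)).2 ∧ (w (i + 1)).1 = (w (i + 2)).1) ∨
    ((w i).1 = (w (i + 1)).1 ∧ (w (i + 1)).2 = (w (i + 2)).2)
  disj : ∀ i j, i + 1 < j → j + 1 < i + n →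
    Disjoint (affineSegment ℝ (w i) (w (i + 1))) (affineSegment ℝ (w j) (w (j + 1)))
  mono : ∃ s k, k ≤ n ∧ (∀ i < k, (w (s + i)).1 ≤ (w (s + i + 1)).1) ∧
    ∀ i, k ≤ i → i < n → (w (s + i + 1)).1 ≤ (w (s + i)).1

/-- A circuit that starts at the upper or lower end of its leftmost edge: the edges with even index
are horizontal, the first `A` of them are directed to the right, the others to the left. -/
structure StdCircuit (h A : ℕ) (v : ℕ → ℝ × ℝ) : Prop where
  circuit : Circuit (2 * h) v
  pos : 0 < A
  lt : A < h
  hor : ∀ a, (v (2 * a)).2 = (v (2 * a + 1)).2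
  ver : ∀ a, (v (2 * a + 1)).1 = (v (2 * a + 2)).1
  right : ∀ a < A, (v (2 * a)).1 < (v (2 * a + 1)).1
  left : ∀ a, A ≤ a → a < h → (v (2 * a + 1)).1 < (v (2 * a)).1

/-- After vertex `i`, the circuit turns back at a vertical edge that lies locally leftmost. -/
def LeftTurn (w : ℕ → ℝ × ℝ) (i : ℕ) : Prop :=
  (w (i + 1)).1 < (w i).1 ∧ (w (i + 1)).1 = (w (i + 2)).1 ∧ (w (i + 2)).1 < (w (i + 3)).1

namespace Circuit

variable {n : ℕ} {w : ℕ → ℝ × ℝ} (hw : Circuit n w)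
include hw

lemma per_mul (i k : ℕ) : w (i + n * k) = w i := by
  induction k with
  | zero => simp
  | succ k ih => rw [Nat.mul_succ, ← Nat.add_assoc, hw.per, ih]

lemma add_eq_of_mod_eq {i j : ℕ} (hij : i % n = j % n) (d : ℕ) : w (i + d) = w (j + d) := by
  have h1 := Nat.mod_add_div i n
  have h2 := Nat.mod_add_div j n
  rw [show i + d = i % n + d + n * (i / n) by omega, show j + d = j % n + d + n * (j / n) by omega,
    hw.per_mul, hw.per_mul, hij]

lemma shift (F : ℕ) : Circuit n (fun j => w (F + j)) where
  pos := hw.pos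
  per i := by rw [← Nat.add_assoc]; exact hw.per _
  ne i := hw.ne (F + i)
  alt i := hw.alt (F + i)
  disj i j h1 h2 := hw.disj (F + i) (F + j) (by omega) (by omega)
  mono := by
    obtain ⟨s, k, hk, h1, h2⟩ := hw.mono
    -- Start the two chains one or more periods later.
    have e : ∀ i, w (F + (s + (n * F - F) + i)) = w (s + i) := by
      intro i
      have : F ≤ n * F := Nat.le_mul_of_pos_left F hw.pos
      rw [show F + (s + (n * F - F) + i) = s + i + n * F by omega, hw.per_mul]
    refine ⟨s + (n * F - F), k, hk, fun i hi => ?_, fun i hi hi' => ?_⟩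
    · rw [Nat.add_assoc _ i 1, e, e]; exact h1 i hi
    · rw [Nat.add_assoc _ i 1, e, e]; exact h2 i hi hi'

lemma horizontal_succ (i : ℕ) :
    (w (i + 1)).2 = (w (i + 2)).2 ↔ ¬(w i).2 = (w (i + 1)).2 := by
  have h1 := hw.ne i
  have h2 := hw.ne (i + 1)
  rcases hw.alt i with ⟨h3, h4⟩ | ⟨h3, h4⟩
  · exact iff_of_false (fun h => h2 (Prod.ext h4 h)) (not_not.2 h3)
  · exact iff_of_true h4 fun h => h1 (Prod.ext h3 h)

lemma vertical_of_horizontal {i : ℕ} (h : (w i).2 = (w (i + 1)).2) :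
    (w (i + 1)).1 = (w (i + 2)).1 := by
  rcases hw.alt i with ⟨-, h4⟩ | ⟨h3, -⟩
  · exact h4
  · exact absurd (Prod.ext h3 h) (hw.ne i)

lemma horizontal_add_two_mul (i a : ℕ) :
    (w (i + 2 * a)).2 = (w (i + 2 * a + 1)).2 ↔ (w i).2 = (w (i + 1)).2 := by
  induction a with
  | zero => simp
  | succ a ih =>
    rw [← ih, show i + 2 * (a + 1) = i + 2 * a + 1 + 1 by ring, hw.horizontal_succ,
      hw.horizontal_succ, not_not]

lemma even : ∃ h, n = 2 * h := by
  rcases Nat.even_or_odd' n with ⟨h, h1 | h1⟩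
  · exact ⟨h, h1⟩
  · exfalso
    have h2 := hw.horizontal_add_two_mul 0 h
    have h3 := hw.horizontal_succ (0 + 2 * h)
    have e1 : w (0 + 2 * h + 1) = w 0 := by
      rw [show 0 + 2 * h + 1 = 0 + n by omega, hw.per]
    have e2 : w (0 + 2 * h + 2) = w 1 := by
      rw [show 0 + 2 * h + 2 = 1 + n by omega, hw.per]
    rw [e1, e2] at h3
    rw [e1] at h2
    tauto

/-- Every circuit is in standard form when started at a suitable vertex. -/
lemma exists_std : ∃ F h A, n = 2 * h ∧ StdCircuit h A (fun j => w (F + j)) := by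
  obtain ⟨h, rfl⟩ := hw.even
  obtain ⟨s, k, hk, h1, h2⟩ := hw.mono
  -- Start at the first horizontal edge from `s` on.
  obtain ⟨t, ht, hhor⟩ : ∃ t ≤ 1, (w (s + t)).2 = (w (s + t + 1)).2 := by
    by_cases hs : (w s).2 = (w (s + 1)).2
    · exact ⟨0, by omega, hs⟩
    · exact ⟨1, le_rfl, (hw.horizontal_succ s).2 hs⟩
  have hpos := hw.pos
  set v : ℕ → ℝ × ℝ := fun j => w (s + t + j) with hv
  have hor : ∀ a, (v (2 * a)).2 = (v (2 * a + 1)).2 := fun a =>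
    (hw.horizontal_add_two_mul (s + t) a).2 hhor
  have ver : ∀ a, (v (2 * a + 1)).1 = (v (2 * a + 2)).1 := fun a =>
    hw.vertical_of_horizontal (hor a)
  have hne : ∀ a, (v (2 * a)).1 ≠ (v (2 * a + 1)).1 := fun a e => hw.ne _ (Prod.ext e (hor a))
  have right : ∀ a, t + 2 * a < k → (v (2 * a)).1 < (v (2 * a + 1)).1 := by
    intro a ha
    refine lt_of_le_of_ne ?_ (hne a)
    have := h1 (t + 2 * a) ha
    simpa only [hv, Nat.add_assoc] using this
  have left : ∀ a, k ≤ t + 2 * a → a < h → (v (2 * a + 1)).1 < (v (2 * a)).1 := by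
    intro a ha hah
    refine lt_of_le_of_ne ?_ (hne a).symm
    have := h2 (t + 2 * a) ha (by omega)
    simpa only [hv, Nat.add_assoc] using this
  have hclosed : v (2 * h) = v 0 := by
    simp only [hv]
    exact hw.per _
  -- The abscissa cannot increase, nor decrease, all the way around.
  have hright : ¬ t + 2 * (h - 1) < k := by
    intro hlt
    have hinc : ∀ a, a < h → (v 0).1 < (v (2 * a + 2)).1 := by
      intro a
      induction a with
      | zero => exact fun _ => (ver 0) ▸ right 0 (by omega)
      | succ a ih =>
        intro ha
        exact ((ih (by omega)).trans (right (a + 1) (by omega))).trans_eq (ver (a + 1))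
    have := hinc (h - 1) (by omega)
    rw [show 2 * (h - 1) + 2 = 2 * h by omega, hclosed] at this
    exact lt_irrefl _ this
  have hleft : t < k := by
    by_contra hlt
    have hdec : ∀ a, a < h → (v (2 * a + 2)).1 < (v 0).1 := by
      intro a
      induction a with
      | zero => exact fun ha => (ver 0) ▸ left 0 (by omega) ha
      | succ a ih =>
        intro ha
        exact ((ver (a + 1)).symm.trans_lt (left (a + 1) (by omega) ha)).trans (ih (by omega))
    have := hdec (h - 1) (by omega)
    rw [show 2 * (h - 1) + 2 = 2 * h by omega, hclosed] at this
    exact lt_irrefl _ this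
  exact ⟨s + t, h, (k + 1 - t) / 2, rfl, hw.shift _, by omega, by omega, hor, ver,
    fun a ha => right a (by omega), fun a ha => left a (by omega)⟩

lemma leftTurn_mod {i j : ℕ} (hij : i % n = j % n) (h : LeftTurn w i) : LeftTurn w j := by
  have key : ∀ d, w (j + d) = w (i + d) := hw.add_eq_of_mod_eq hij.symm
  have := key 0
  simp only [Nat.add_zero] at this
  simpa only [LeftTurn, key, this] using h

lemma exists_leftTurn : ∃ i < n, LeftTurn w i := by
  obtain ⟨F, h, A, rfl, hs⟩ := hw.exists_std
  have h1 := hs.pos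
  have h2 := hs.lt
  refine ⟨(F + 2 * (h - 1)) % (2 * h), Nat.mod_lt _ hw.pos, hw.leftTurn_mod (Nat.mod_mod _ _).symm ?_⟩
  have h3 := hs.left (h - 1) (by omega) (by omega)
  have h4 := hs.ver (h - 1)
  have h5 := hs.right 0 h1
  refine ⟨h3, h4, ?_⟩
  have e1 : F + 2 * (h - 1) + 2 = F + 2 * 0 + 2 * h := by omega
  have e2 : F + 2 * (h - 1) + 3 = F + (2 * 0 + 1) + 2 * h := by omega
  rw [e1, e2, hw.per, hw.per]
  exact h5

/-- A left turn occurs only at the leftmost edge. -/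
lemma std_of_leftTurn {i : ℕ} (hi : LeftTurn w i) :
    ∃ h A, n = 2 * h ∧ StdCircuit h A (fun j => w (i + 2 + j)) := by
  obtain ⟨F, h, A, rfl, hs⟩ := hw.exists_std
  refine ⟨h, A, rfl, ?_⟩
  set v : ℕ → ℝ × ℝ := fun j => w (F + j) with hv
  obtain ⟨j, hj, hij⟩ : ∃ j < 2 * h, (i + 2) % (2 * h) = (F + j) % (2 * h) := by
    refine ⟨(i + 2 + (2 * h * F - F)) % (2 * h), Nat.mod_lt _ hw.pos, ?_⟩
    have : F ≤ 2 * h * F := Nat.le_mul_of_pos_left F hw.pos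
    rw [Nat.add_mod_mod, show F + (i + 2 + (2 * h * F - F)) = i + 2 + 2 * h * F by omega,
      Nat.add_mul_mod_self_left]
  have key : ∀ d, w (i + 2 + d) = v (j + d) := by
    intro d
    simp only [hv, ← Nat.add_assoc]
    exact hw.add_eq_of_mod_eq hij d
  have k0 : w (i + 2) = v j := key 0
  have k1 : w (i + 3) = v (j + 1) := key 1
  have hlt := hs.lt
  have h3 := hi.2.2
  rw [k0, k1] at h3
  have hj0 : j = 0 := by
    rcases Nat.even_or_odd' j with ⟨a, rfl | rfl⟩
    · by_contra ha
      have hA : a < A := by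
        by_contra hA
        exact (hs.left a (not_lt.1 hA) (by omega)).not_gt h3
      have k2 : w i = v (2 * (a - 1)) := by
        have := key (2 * h - 2)
        rw [show i + 2 + (2 * h - 2) = i + 2 * h by omega, hw.per,
          show 2 * a + (2 * h - 2) = 2 * (a - 1) + 2 * h by omega, hs.circuit.per] at this
        exact this
      have k3 : w (i + 1) = v (2 * (a - 1) + 1) := by
        have := key (2 * h - 1)
        rw [show i + 2 + (2 * h - 1) = i + 1 + 2 * h by omega, hw.per,
          show 2 * a + (2 * h - 1) = 2 * (a - 1) + 1 + 2 * h by omega, hs.circuit.per] at this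
        exact this
      have h4 := hi.1
      rw [k2, k3] at h4
      exact h4.not_gt (hs.right (a - 1) (by omega))
    · exact absurd (hs.ver a) h3.ne
  have : (fun d => w (i + 2 + d)) = v := by
    funext d
    rw [key, hj0, Nat.zero_add]
  rw [this]
  exact hs

end Circuit

/-! ### Vertices of a monotone polygon -/

namespace StdCircuit

variable {h A : ℕ} {v : ℕ → ℝ × ℝ}

/-- Abscissae of the breakpoints of the chain that is traversed to the right. -/
def fx (v : ℕ → ℝ × ℝ) (a : ℕ) : ℝ := (v (2 * a)).1
/-- Heights of the edges of the chain that is traversed to the right. -/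
def fy (v : ℕ → ℝ × ℝ) (a : ℕ) : ℝ := (v (2 * a)).2
/-- Abscissae of the breakpoints of the other chain, from left to right. -/
def gx (h : ℕ) (v : ℕ → ℝ × ℝ) (b : ℕ) : ℝ := (v (2 * h - 1 - 2 * b)).1
/-- Heights of the edges of the other chain, from left to right. -/
def gy (h : ℕ) (v : ℕ → ℝ × ℝ) (b : ℕ) : ℝ := (v (2 * h - 1 - 2 * b)).2

/-- The edge from vertex `i` of a circuit to the next vertex. -/
def edge (v : ℕ → ℝ × ℝ) (i : ℕ) : Set (ℝ × ℝ) := affineSegment ℝ (v i) (v (i + 1))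

variable (hs : StdCircuit h A v)
include hs

lemma mem_edge_hor {a : ℕ} {z : ℝ × ℝ} :
    z ∈ edge v (2 * a) ↔ z.1 ∈ uIcc (v (2 * a)).1 (v (2 * a + 1)).1 ∧ z.2 = (v (2 * a)).2 :=
  mem_affineSegment_of_snd_eq (hs.hor a)

lemma mem_edge_ver {a : ℕ} {z : ℝ × ℝ} :
    z ∈ edge v (2 * a + 1) ↔
      z.1 = (v (2 * a + 2)).1 ∧ z.2 ∈ uIcc (v (2 * a + 1)).2 (v (2 * a + 2)).2 := by
  rw [← hs.ver a]
  exact mem_affineSegment_of_fst_eq (hs.ver a)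

lemma gx_succ {b : ℕ} (hb : b < h - A) : gx h v (b + 1) = (v (2 * (h - 1 - b))).1 := by
  have h1 := hs.ver (h - 1 - (b + 1))
  have h2 := hs.pos
  rw [gx, show 2 * h - 1 - 2 * (b + 1) = 2 * (h - 1 - (b + 1)) + 1 by omega, h1]
  congr 2
  omega

omit hs in
lemma gx_eq {b : ℕ} (hb : b < h - A) : gx h v b = (v (2 * (h - 1 - b) + 1)).1 := by
  rw [gx]
  congr 2
  omega

omit hs in
lemma gy_eq {b : ℕ} (hb : b < h - A) : gy h v b = (v (2 * (h - 1 - b) + 1)).2 := by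
  rw [gy]
  congr 2
  omega

lemma chain_fx : chain A (fx v) (fy v) = ⋃ i ∈ {i | i < 2 * A - 1}, edge v i := by
  have h1 := hs.pos
  ext z
  simp only [chain, mem_union, mem_ofPred_eq, mem_iUnion, exists_prop]
  have e1 : ∀ a, fx v (a + 1) = (v (2 * a + 1)).1 := fun a => (hs.ver a).symm
  have e2 : ∀ a, fy v a = (v (2 * a + 1)).2 := fun a => hs.hor a
  constructor
  · rintro (⟨a, ha, hz, hz'⟩ | ⟨a, ha, hz, hz'⟩)
    · refine ⟨2 * a, by omega, hs.mem_edge_hor.2 ⟨?_, hz'⟩⟩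
      rw [uIcc_of_le (hs.right a ha).le]
      exact ⟨hz.1, e1 a ▸ hz.2⟩
    · refine ⟨2 * a + 1, by omega, hs.mem_edge_ver.2 ⟨hz, ?_⟩⟩
      rw [← e2]
      exact hz'
  · rintro ⟨i, hi, hz⟩
    rcases Nat.even_or_odd' i with ⟨a, rfl | rfl⟩
    · obtain ⟨hz1, hz2⟩ := hs.mem_edge_hor.1 hz
      have ha : a < A := by omega
      rw [uIcc_of_le (hs.right a ha).le] at hz1
      exact Or.inl ⟨a, ha, ⟨hz1.1, (e1 a).symm ▸ hz1.2⟩, hz2⟩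
    · obtain ⟨hz1, hz2⟩ := hs.mem_edge_ver.1 hz
      rw [← e2] at hz2
      exact Or.inr ⟨a, by omega, hz1, hz2⟩

lemma chain_gx : chain (h - A) (gx h v) (gy h v) =
    ⋃ i ∈ {i | 2 * A ≤ i ∧ i + 1 < 2 * h}, edge v i := by
  have h1 := hs.lt
  ext z
  simp only [chain, mem_union, mem_ofPred_eq, mem_iUnion, exists_prop]
  constructor
  · rintro (⟨b, hb, hz, hz'⟩ | ⟨b, hb, hz, hz'⟩)
    · refine ⟨2 * (h - 1 - b), by omega, hs.mem_edge_hor.2 ⟨?_, ?_⟩⟩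
      · rw [uIcc_of_ge (hs.left _ (by omega) (by omega)).le]
        exact ⟨gx_eq hb ▸ hz.1, hs.gx_succ hb ▸ hz.2⟩
      · rw [hs.hor, ← gy_eq hb]
        exact hz'
    · refine ⟨2 * (h - 1 - (b + 1)) + 1, by omega, hs.mem_edge_ver.2 ?_⟩
      rw [← gy_eq hb, show 2 * (h - 1 - (b + 1)) + 2 = 2 * (h - 1 - b) by omega,
        ← hs.gx_succ (by omega), hs.hor, ← gy_eq (A := A) (by omega), uIcc_comm]
      exact ⟨hz, hz'⟩
  · rintro ⟨i, ⟨hi, hi'⟩, hz⟩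
    rcases Nat.even_or_odd' i with ⟨a, rfl | rfl⟩
    · obtain ⟨hz1, hz2⟩ := hs.mem_edge_hor.1 hz
      rw [uIcc_of_ge (hs.left a (by omega) (by omega)).le] at hz1
      have hb : h - 1 - a < h - A := by omega
      have e : h - 1 - (h - 1 - a) = a := by omega
      refine Or.inl ⟨h - 1 - a, hb, ⟨?_, ?_⟩, ?_⟩
      · rw [gx_eq hb, e]; exact hz1.1
      · rw [hs.gx_succ hb, e]; exact hz1.2
      · rw [gy_eq hb, e, ← hs.hor]; exact hz2
    · have hz := hs.mem_edge_ver.1 hz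
      have hb : h - 1 - (a + 1) + 1 < h - A := by omega
      refine Or.inr ⟨h - 1 - (a + 1), hb, ?_⟩
      rw [hs.gx_succ (by omega), gy_eq hb, gy_eq (A := A) (by omega), ← hs.hor,
        show h - 1 - (h - 1 - (a + 1)) = a + 1 by omega,
        show h - 1 - (h - 1 - (a + 1) + 1) = a by omega, uIcc_comm]
      exact hz

lemma chainPair : ChainPair A (h - A) (fx v) (gx h v) (fy v) (gy h v) where
  posA := hs.pos
  posB := Nat.sub_pos_of_lt hs.lt
  p_lt a ha := (hs.right a ha).trans_eq (hs.ver a)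
  q_lt b hb := by
    have := hs.lt
    rw [gx_eq hb, hs.gx_succ hb]
    exact hs.left _ (by omega) (by omega)
  left := by
    have h1 := hs.lt
    have h2 := hs.ver (h - 1)
    have h3 := hs.circuit.per 0
    rw [show 2 * (h - 1) + 2 = 0 + 2 * h by omega, h3] at h2
    rw [fx, gx, show 2 * h - 1 - 2 * 0 = 2 * (h - 1) + 1 by omega, h2]
  right := by
    have h1 := hs.lt
    have h0 := hs.pos
    have h2 := hs.ver (A - 1)
    rw [fx, gx, show 2 * h - 1 - 2 * (h - A) = 2 * (A - 1) + 1 by omega, h2]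
    congr 2
    omega
  disj := by
    rw [hs.chain_fx, hs.chain_gx]
    simp only [disjoint_iUnion_left, disjoint_iUnion_right, mem_ofPred_eq]
    exact fun j hj i hi => hs.circuit.disj _ _ (by omega) (by omega)

lemma chainBoundary_eq : chainBoundary A (h - A) (fx v) (gx h v) (fy v) (gy h v) =
    ⋃ i ∈ {i | i < 2 * h}, edge v i := by
  have h0 := hs.pos
  have h1 := hs.lt
  have eL : {z : ℝ × ℝ | z.1 = fx v 0 ∧ z.2 ∈ uIcc (fy v 0) (gy h v 0)} =
      edge v (2 * h - 1) := by
    ext z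
    rw [show 2 * h - 1 = 2 * (h - 1) + 1 by omega, hs.mem_edge_ver,
      show 2 * (h - 1) + 2 = 0 + 2 * h by omega, hs.circuit.per, gy_eq (A := A) (by omega), uIcc_comm]
    rfl
  have eR : {z : ℝ × ℝ | z.1 = fx v A ∧ z.2 ∈ uIcc (fy v (A - 1)) (gy h v (h - A - 1))} =
      edge v (2 * A - 1) := by
    ext z
    rw [show 2 * A - 1 = 2 * (A - 1) + 1 by omega, hs.mem_edge_ver, ← hs.hor (A - 1),
      gy_eq (A := A) (by omega), ← hs.hor (h - 1 - (h - A - 1)), show 2 * (h - 1 - (h - A - 1)) = 2 * (A - 1) + 2 by omega, fx,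
      show 2 * A = 2 * (A - 1) + 2 by omega]
    rfl
  rw [chainBoundary, eL, eR, hs.chain_fx, hs.chain_gx]
  ext z
  simp only [mem_union, mem_iUnion, mem_ofPred_eq, exists_prop]
  constructor
  · rintro (((⟨i, hi, hz⟩ | ⟨i, hi, hz⟩) | hz) | hz)
    · exact ⟨i, by omega, hz⟩
    · exact ⟨i, by omega, hz⟩
    · exact ⟨_, by omega, hz⟩
    · exact ⟨_, by omega, hz⟩
  · rintro ⟨i, hi, hz⟩
    by_cases h2 : i = 2 * h - 1
    · exact Or.inl (Or.inr (h2 ▸ hz))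
    by_cases h3 : i = 2 * A - 1
    · exact Or.inr (h3 ▸ hz)
    by_cases h4 : i < 2 * A - 1
    · exact Or.inl (Or.inl (Or.inl ⟨i, h4, hz⟩))
    · exact Or.inl (Or.inl (Or.inr ⟨i, by omega, hz⟩))

end StdCircuit

/-- The vertices of a polygon as a periodic sequence. -/
def vert {n : ℕ} (hn : 0 < n) (P : Polygon (ℝ × ℝ) n) (i : ℕ) : ℝ × ℝ :=
  P ⟨i % n, Nat.mod_lt i hn⟩

section Polygon

variable {n : ℕ} (hn : 0 < n) (P : Polygon (ℝ × ℝ) n)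

lemma finRotate_mk_mod (i : ℕ) :
    finRotate n ⟨i % n, Nat.mod_lt i hn⟩ = ⟨(i + 1) % n, Nat.mod_lt _ hn⟩ := by
  obtain ⟨n, rfl⟩ : ∃ k, n = k + 1 := ⟨n - 1, by omega⟩
  rw [finRotate_apply]
  apply Fin.ext
  rw [Fin.val_add]
  simp

lemma vert_finRotate (i : ℕ) : P (finRotate n ⟨i % n, Nat.mod_lt i hn⟩) = vert hn P (i + 1) := by
  rw [finRotate_mk_mod hn]
  rfl

lemma finRotate_iterate (s : Fin n) (i : ℕ) :
    (finRotate n)^[i] s = ⟨(s + i) % n, Nat.mod_lt _ hn⟩ := by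
  induction i with
  | zero => exact Fin.ext (Nat.mod_eq_of_lt s.2).symm
  | succ i ih => rw [Function.iterate_succ_apply', ih, finRotate_mk_mod hn]; rfl

lemma edgeSet_eq (i : ℕ) :
    P.edgeSet ℝ ⟨i % n, Nat.mod_lt i hn⟩ = StdCircuit.edge (vert hn P) i := by
  rw [Polygon.edgeSet, vert_finRotate hn P]
  rfl

lemma mod_ne_mod {n i j : ℕ} (h1 : i < j) (h2 : j < i + n) : i % n ≠ j % n := by
  intro h
  have h3 : n ∣ j - i := (Nat.modEq_iff_dvd' h1.le).1 h
  have := Nat.le_of_dvd (by omega) h3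
  omega

variable {P}

lemma circuit_vert (h1 : IsSimple P) (h2 : IsOrthogonal P) (h3 : IsXMonotone P) :
    Circuit n (vert hn P) where
  pos := hn
  per i := by simp only [vert, Nat.add_mod_right]
  ne i := by
    have := h1.2.1 ⟨i % n, Nat.mod_lt i hn⟩
    rwa [vert_finRotate hn P] at this
  alt i := by
    have := h2 ⟨i % n, Nat.mod_lt i hn⟩
    simp only [IsHorizontalEdge, IsVerticalEdge, finRotate_mk_mod hn] at this
    exact this
  disj i j hij hji := by
    have := h1.2.2.2 ⟨i % n, Nat.mod_lt i hn⟩ ⟨j % n, Nat.mod_lt j hn⟩ ?_ ?_ ?_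
    · rwa [edgeSet_eq hn, edgeSet_eq hn] at this
    · rw [Ne, Fin.mk.injEq]
      exact mod_ne_mod (by omega) (by omega)
    · rw [finRotate_mk_mod hn, Ne, Fin.mk.injEq]
      exact (mod_ne_mod (by omega) (by omega)).symm
    · rw [finRotate_mk_mod hn, Ne, Fin.mk.injEq]
      exact mod_ne_mod (by omega) (by omega)
  mono := by
    obtain ⟨s, k, hk, h4, h5⟩ := h3
    refine ⟨s, k, hk, fun i hi => ?_, fun i hi hi' => ?_⟩
    · have := h4 i hi
      rwa [finRotate_iterate hn, finRotate_iterate hn] at this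
    · have := h5 i hi hi'
      rwa [finRotate_iterate hn, finRotate_iterate hn] at this

lemma boundary_eq (i₀ : ℕ) :
    P.boundary ℝ = ⋃ i ∈ {i | i < n}, StdCircuit.edge (fun j => vert hn P (i₀ + j)) i := by
  ext z
  simp only [Polygon.boundary, mem_iUnion, mem_ofPred_eq, exists_prop]
  have he : ∀ i, StdCircuit.edge (fun j => vert hn P (i₀ + j)) i =
      P.edgeSet ℝ ⟨(i₀ + i) % n, Nat.mod_lt _ hn⟩ := fun i => (edgeSet_eq hn P (i₀ + i)).symm
  constructor
  · rintro ⟨i, hz⟩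
    refine ⟨(i + (n * i₀ - i₀)) % n, Nat.mod_lt _ hn, ?_⟩
    rw [he]
    convert hz using 2
    apply Fin.ext
    have : i₀ ≤ n * i₀ := Nat.le_mul_of_pos_left i₀ hn
    change (i₀ + (i + (n * i₀ - i₀)) % n) % n = i
    rw [Nat.add_mod_mod, show i₀ + (i + (n * i₀ - i₀)) = i + n * i₀ by omega,
      Nat.add_mul_mod_self_left, Nat.mod_eq_of_lt i.2]
  · rintro ⟨i, -, hz⟩
    rw [he] at hz
    exact ⟨_, hz⟩

/-- A simple orthogonal `x`-monotone polygon is the union of the slabs between its two chains. -/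
theorem region_eq_slabs {h A i₀ : ℕ} (hnh : n = 2 * h)
    (hs : StdCircuit h A (fun j => vert hn P (i₀ + j))) {a b : ℕ → ℕ} {x : ℕ → ℝ} {m : ℕ}
    (hm : IsMerge A (h - A) (StdCircuit.fx fun j => vert hn P (i₀ + j))
      (StdCircuit.gx h fun j => vert hn P (i₀ + j)) a b x m) :
    region P = (mergeSlabs (StdCircuit.fy fun j => vert hn P (i₀ + j))
      (StdCircuit.gy h fun j => vert hn P (i₀ + j)) a b x m).region := by
  have h1 := hm.region_eq hs.chainPair
  rw [hs.chainBoundary_eq, ← hnh, ← boundary_eq hn] at h1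
  exact h1

end Polygon

end ArtGallery

/-! ### Running time of programs -/

namespace GeomRAM

/-- Effect of a program without loops. -/
noncomputable def Prog.den : Prog → State → State
  | .skip, s => s
  | .setVar v e, s => s.setVar v (e.eval s)
  | .setArr a i e, s => s.setArr a (i.eval s) (e.eval s)
  | .rcopy a i b j, s => s.setReal a (i.eval s) (s.rarr b (j.eval s))
  | .seq p q, s => q.den (p.den s)
  | .ite c p q, s => open Classical in if c.Holds s then p.den s else q.den s
  | .loop _ _, s => s

lemma den_seq (p q : Prog) (s : State) : (Prog.seq p q).den s = q.den (p.den s) := rfl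

lemma den_setVar (v : ℕ) (e : IExpr) (s : State) :
    (Prog.setVar v e).den s = s.setVar v (e.eval s) := rfl

lemma Prog.den_ite_pos {c : Cond} {p q : Prog} {s : State} (h : c.Holds s) :
    (Prog.ite c p q).den s = p.den s := if_pos h

lemma Prog.den_ite_neg {c : Cond} {p q : Prog} {s : State} (h : ¬c.Holds s) :
    (Prog.ite c p q).den s = q.den s := if_neg h

/-- Upper bound for the number of steps of a program without loops. -/
def Prog.cost : Prog → ℕ
  | .seq p q => p.cost + q.cost
  | .ite _ p q => p.cost + q.cost + 1
  | _ => 1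

/-- The program has no loops. -/
def Prog.LoopFree : Prog → Prop
  | .seq p q => p.LoopFree ∧ q.LoopFree
  | .ite _ p q => p.LoopFree ∧ q.LoopFree
  | .loop _ _ => False
  | _ => True

/-- The program leads from `s` to `s'` in at most `K` steps. -/
def Reach (p : Prog) (s s' : State) (K : ℕ) : Prop := ∃ t ≤ K, Exec p s s' t

lemma Prog.LoopFree.reach {p : Prog} (hp : p.LoopFree) (s : State) :
    Reach p s (p.den s) p.cost := by
  induction p generalizing s with
  | skip => exact ⟨1, le_rfl, .skip s⟩
  | setVar v e => exact ⟨1, le_rfl, .setVar s v e⟩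
  | setArr a i e => exact ⟨1, le_rfl, .setArr s a i e⟩
  | rcopy a i b j => exact ⟨1, le_rfl, .rcopy s a i b j⟩
  | seq p q ihp ihq =>
    obtain ⟨t, ht, h⟩ := ihp hp.1 s
    obtain ⟨t', ht', h'⟩ := ihq hp.2 (p.den s)
    exact ⟨t + t', Nat.add_le_add ht ht', .seq h h'⟩
  | ite c p q ihp ihq =>
    simp only [Prog.cost]
    by_cases hc : c.Holds s
    · rw [Prog.den_ite_pos hc]
      obtain ⟨t, ht, h⟩ := ihp hp.1 s
      exact ⟨t + 1, by omega, .iteTrue hc h⟩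
    · rw [Prog.den_ite_neg hc]
      obtain ⟨t, ht, h⟩ := ihq hp.2 s
      exact ⟨t + 1, by omega, .iteFalse hc h⟩
  | loop c p _ => exact hp.elim

lemma Reach.seq {p q : Prog} {s s' s'' : State} {K L : ℕ} (h : Reach p s s' K)
    (h' : Reach q s' s'' L) : Reach (.seq p q) s s'' (K + L) := by
  obtain ⟨t, ht, h⟩ := h
  obtain ⟨t', ht', h'⟩ := h'
  exact ⟨t + t', Nat.add_le_add ht ht', .seq h h'⟩

/-- Loop rule: the invariant `I` carries the number of iterations done so far; the loop stops after
`N` iterations. -/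
lemma reach_loop {c : Cond} {p : Prog} (hp : p.LoopFree) {I : ℕ → State → Prop} {N : ℕ}
    (hend : ∀ s, I N s → ¬c.Holds s) (hgo : ∀ k < N, ∀ s, I k s → c.Holds s)
    (hstep : ∀ k < N, ∀ s, I k s → I (k + 1) (p.den s)) {s : State} (h0 : I 0 s) :
    ∃ s', Reach (.loop c p) s s' (N * (p.cost + 1) + 1) ∧ I N s' := by
  have key : ∀ d k, k + d = N → ∀ s, I k s →
      ∃ s', Reach (.loop c p) s s' (d * (p.cost + 1) + 1) ∧ I N s' := by
    intro d
    induction d with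
    | zero =>
      intro k hk s hs
      obtain rfl : k = N := by omega
      exact ⟨s, ⟨1, by omega, .loopFalse (hend s hs)⟩, hs⟩
    | succ d ih =>
      intro k hk s hs
      obtain ⟨s', ⟨t', ht', h'⟩, hI⟩ := ih (k + 1) (by omega) _ (hstep k (by omega) s hs)
      obtain ⟨t, ht, h⟩ := hp.reach s
      refine ⟨s', ⟨t + t' + 1, ?_, .loopTrue (hgo k (by omega) s hs) h h'⟩, hI⟩
      rw [Nat.succ_mul]
      omega
  exact key N 0 (by omega) s h0

end GeomRAM

/-! ### The program of the sweep -/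

namespace ArtGallery

open GeomRAM Slabs

namespace Algo

/-- `seqs [p₁, …, pₖ]` executes the programs one after the other. -/
def seqs : List Prog → Prog
  | [] => .skip
  | [p] => p
  | p :: ps => .seq p (seqs ps)

/-- Increment a register. -/
def inc (v : ℕ) : Prog := .setVar v (.succ (.var v))

/-- `a[0] := max a[0] b[j]`. -/
def setMax (a b : ℕ) (j : IExpr) : Prog :=
  .ite (.rlt a (.const 0) b j) (.rcopy a (.const 0) b j) .skip

/-- `a[0] := min a[0] b[j]`. -/
def setMin (a b : ℕ) (j : IExpr) : Prog :=
  .ite (.rlt b j a (.const 0)) (.rcopy a (.const 0) b j) .skip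

/-- The machine state as a state of the sweep: registers `8`, `9`, `10` hold the integers, the
first cells of the real arrays `7` to `14` hold the interval ends, and the guards are in the output
arrays. -/
def sweepOf (s : State) : Sweep where
  c := s.ivar 8
  kv := s.ivar 9
  act := s.ivar 10
  kl := s.rarr 7 0
  kh := s.rarr 8 0
  jl := s.rarr 9 0
  jh := s.rarr 10 0
  ul := s.rarr 11 0
  uh := s.rarr 12 0
  nl := s.rarr 13 0
  nh := s.rarr 14 0
  X := s.rarr 2
  Y := s.rarr 3

/-- The slabs in the real arrays `4`, `5`, `6`, and the registers `6`, `7` that hold the number of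
slabs and the current slab, are the same in both states. -/
structure Frame (s s' : State) : Prop where
  m : s'.ivar 6 = s.ivar 6
  k : s'.ivar 7 = s.ivar 7
  x : s'.rarr 4 = s.rarr 4
  l : s'.rarr 5 = s.rarr 5
  u : s'.rarr 6 = s.rarr 6

lemma Frame.trans {s s' s'' : State} (h : Frame s s') (h' : Frame s' s'') : Frame s s'' :=
  ⟨h'.m.trans h.m, h'.k.trans h.k, h'.x.trans h.x, h'.l.trans h.l, h'.u.trans h.u⟩

/-- Program for `Sweep.place`, at the breakpoint whose number is in register `7`. -/
def place : Prog := seqs [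
  .rcopy 2 (.var 8) 4 (.var 7),
  .rcopy 3 (.var 8) 13 (.const 0),
  inc 8]

/-- Program for `Sweep.commit`. -/
def commit : Prog :=
  .ite (.and (.ieq (.var 10) (.const 1))
      (.not (.and (.not (.rlt 11 (.const 0) 5 (.var 7))) (.not (.rlt 6 (.var 7) 12 (.const 0))))))
    (seqs [place, .setVar 9 (.const 1), .setVar 10 (.const 0),
      .rcopy 7 (.const 0) 13 (.const 0), .rcopy 8 (.const 0) 14 (.const 0),
      .rcopy 9 (.const 0) 5 (.var 7), .rcopy 10 (.const 0) 6 (.var 7)])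
    .skip

/-- Program for `Sweep.serve`. -/
def serve : Prog :=
  .ite (.ieq (.var 9) (.const 1))
    (seqs [setMax 7 5 (.var 7), setMin 8 6 (.var 7),
      .ite (.rlt 8 (.const 0) 7 (.const 0)) (.setVar 9 (.const 0))
        (.rcopy 3 (.pred (.var 8)) 7 (.const 0))])
    .skip

/-- Program for `Sweep.view`. -/
def view : Prog :=
  .ite (.ieq (.var 9) (.const 1))
    (seqs [setMax 9 5 (.var 7), setMin 10 6 (.var 7)])
    (seqs [.rcopy 9 (.const 0) 6 (.var 7), .rcopy 10 (.const 0) 5 (.var 7)])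

/-- Program for `Sweep.start`. -/
def start : Prog :=
  .ite (.ieq (.var 10) (.const 0))
    (seqs [.rcopy 11 (.const 0) 6 (.var 7), .rcopy 12 (.const 0) 5 (.var 7),
      .rcopy 13 (.const 0) 5 (.var 7), .rcopy 14 (.const 0) 6 (.var 7)])
    .skip

/-- Program for `Sweep.addLow`. -/
def addLow : Prog :=
  .ite (.rlt 5 (.var 7) 9 (.const 0))
    (seqs [.setVar 10 (.const 1), setMin 11 5 (.var 7), setMax 12 9 (.const 0)])
    .skip

/-- Program for `Sweep.addHigh`. -/
def addHigh : Prog :=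
  .ite (.rlt 10 (.const 0) 6 (.var 7))
    (seqs [.setVar 10 (.const 1), setMin 11 10 (.const 0), setMax 12 6 (.var 7)])
    .skip

/-- Program for `Sweep.narrow`. -/
def narrow : Prog := seqs [setMax 13 5 (.var 7), setMin 14 6 (.var 7)]

section Den

variable (s : State)

lemma den_setMax (a b : ℕ) (j : IExpr) : (setMax a b j).den s =
    s.setReal a 0 (max (s.rarr a 0) (s.rarr b (j.eval s))) := by
  by_cases h : s.rarr a 0 < s.rarr b (j.eval s)
  · rw [setMax, Prog.den_ite_pos (by exact h), max_eq_right h.le]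
    rfl
  · rw [setMax, Prog.den_ite_neg (by exact h), max_eq_left (not_lt.1 h)]
    simp [State.setReal, Prog.den]

lemma den_setMin (a b : ℕ) (j : IExpr) : (setMin a b j).den s =
    s.setReal a 0 (min (s.rarr a 0) (s.rarr b (j.eval s))) := by
  by_cases h : s.rarr b (j.eval s) < s.rarr a 0
  · rw [setMin, Prog.den_ite_pos (by exact h), min_eq_right h.le]
    rfl
  · rw [setMin, Prog.den_ite_neg (by exact h), min_eq_left (not_lt.1 h)]
    simp [State.setReal, Prog.den]

lemma den_place : sweepOf (place.den s) = (sweepOf s).place (s.rarr 4 (s.ivar 7)) ∧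
    Frame s (place.den s) := by
  refine ⟨?_, ⟨?_, ?_, ?_, ?_, ?_⟩⟩ <;>
  simp [place, seqs, inc, Prog.den, sweepOf, Sweep.place, State.setReal, State.setVar, IExpr.eval]

lemma den_commit : sweepOf (commit.den s) = (sweepOf s).commit (s.rarr 4 (s.ivar 7))
    (s.rarr 5 (s.ivar 7)) (s.rarr 6 (s.ivar 7)) ∧ Frame s (commit.den s) := by
  by_cases h : s.ivar 10 = 1 ∧ ¬(¬ s.rarr 11 0 < s.rarr 5 (s.ivar 7) ∧
    ¬ s.rarr 6 (s.ivar 7) < s.rarr 12 0)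
  · rw [commit, Prog.den_ite_pos (by exact h), Sweep.commit, if_pos (by exact h)]
    refine ⟨?_, ⟨?_, ?_, ?_, ?_, ?_⟩⟩ <;>
    simp [place, seqs, inc, Prog.den, sweepOf, Sweep.place, State.setReal, State.setVar, IExpr.eval]
  · rw [commit, Prog.den_ite_neg (by exact h), Sweep.commit, if_neg (by exact h)]
    exact ⟨rfl, rfl, rfl, rfl, rfl, rfl⟩

lemma den_serve : sweepOf (serve.den s) = (sweepOf s).serve
    (s.rarr 5 (s.ivar 7)) (s.rarr 6 (s.ivar 7)) ∧ Frame s (serve.den s) := by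
  by_cases h : s.ivar 9 = 1
  · rw [serve, Prog.den_ite_pos (by exact h), Sweep.serve, if_pos (by exact h)]
    simp only [seqs, den_seq, den_setMax, den_setMin]
    by_cases h' : min (s.rarr 8 0) (s.rarr 6 (s.ivar 7)) < max (s.rarr 7 0) (s.rarr 5 (s.ivar 7))
    · rw [Prog.den_ite_pos, if_pos (by exact h')]
      · refine ⟨?_, ⟨?_, ?_, ?_, ?_, ?_⟩⟩ <;>
        simp [Prog.den, sweepOf, State.setReal, State.setVar, IExpr.eval]
      · exact h'
    · rw [Prog.den_ite_neg, if_neg (by exact h')]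
      · refine ⟨?_, ⟨?_, ?_, ?_, ?_, ?_⟩⟩ <;>
        simp [Prog.den, sweepOf, State.setReal, IExpr.eval]
      · exact h'
  · rw [serve, Prog.den_ite_neg (by exact h), Sweep.serve, if_neg (by exact h)]
    exact ⟨rfl, rfl, rfl, rfl, rfl, rfl⟩

lemma den_view : sweepOf (view.den s) = (sweepOf s).view
    (s.rarr 5 (s.ivar 7)) (s.rarr 6 (s.ivar 7)) ∧ Frame s (view.den s) := by
  by_cases h : s.ivar 9 = 1
  · rw [view, Prog.den_ite_pos (by exact h), Sweep.view, if_pos (by exact h)]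
    refine ⟨?_, ⟨?_, ?_, ?_, ?_, ?_⟩⟩ <;>
    simp [seqs, den_seq, den_setMax, den_setMin, sweepOf, State.setReal, IExpr.eval]
  · rw [view, Prog.den_ite_neg (by exact h), Sweep.view, if_neg (by exact h)]
    refine ⟨?_, ⟨?_, ?_, ?_, ?_, ?_⟩⟩ <;>
    simp [seqs, Prog.den, sweepOf, State.setReal, IExpr.eval]

lemma den_start : sweepOf (start.den s) = (sweepOf s).start
    (s.rarr 5 (s.ivar 7)) (s.rarr 6 (s.ivar 7)) ∧ Frame s (start.den s) := by
  by_cases h : s.ivar 10 = 0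
  · rw [start, Prog.den_ite_pos (by exact h), Sweep.start, if_pos (by exact h)]
    refine ⟨?_, ⟨?_, ?_, ?_, ?_, ?_⟩⟩ <;>
    simp [seqs, Prog.den, sweepOf, State.setReal, IExpr.eval]
  · rw [start, Prog.den_ite_neg (by exact h), Sweep.start, if_neg (by exact h)]
    exact ⟨rfl, rfl, rfl, rfl, rfl, rfl⟩

lemma den_addLow : sweepOf (addLow.den s) = (sweepOf s).addLow (s.rarr 5 (s.ivar 7)) ∧
    Frame s (addLow.den s) := by
  by_cases h : s.rarr 5 (s.ivar 7) < s.rarr 9 0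
  · rw [addLow, Prog.den_ite_pos (by exact h), Sweep.addLow, if_pos (by exact h)]
    refine ⟨?_, ⟨?_, ?_, ?_, ?_, ?_⟩⟩ <;>
    simp [seqs, den_seq, den_setVar, den_setMax, den_setMin, sweepOf, State.setReal,
      State.setVar, IExpr.eval]
  · rw [addLow, Prog.den_ite_neg (by exact h), Sweep.addLow, if_neg (by exact h)]
    exact ⟨rfl, rfl, rfl, rfl, rfl, rfl⟩

lemma den_addHigh : sweepOf (addHigh.den s) = (sweepOf s).addHigh (s.rarr 6 (s.ivar 7)) ∧
    Frame s (addHigh.den s) := by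
  by_cases h : s.rarr 10 0 < s.rarr 6 (s.ivar 7)
  · rw [addHigh, Prog.den_ite_pos (by exact h), Sweep.addHigh, if_pos (by exact h)]
    refine ⟨?_, ⟨?_, ?_, ?_, ?_, ?_⟩⟩ <;>
    simp [seqs, den_seq, den_setVar, den_setMax, den_setMin, sweepOf, State.setReal,
      State.setVar, IExpr.eval]
  · rw [addHigh, Prog.den_ite_neg (by exact h), Sweep.addHigh, if_neg (by exact h)]
    exact ⟨rfl, rfl, rfl, rfl, rfl, rfl⟩

lemma den_narrow : sweepOf (narrow.den s) = (sweepOf s).narrow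
    (s.rarr 5 (s.ivar 7)) (s.rarr 6 (s.ivar 7)) ∧ Frame s (narrow.den s) := by
  refine ⟨?_, ⟨?_, ?_, ?_, ?_, ?_⟩⟩ <;>
  simp [narrow, Sweep.narrow, seqs, den_seq, den_setMax, den_setMin, sweepOf, State.setReal,
    IExpr.eval]

end Den

/-- Process the slab whose number is in register `7`. -/
def sweepStep : Prog := seqs [commit, serve, view, start, addLow, addHigh, narrow, inc 7]

/-- Compute an optimal guard set for the slabs stored in the real arrays `4`, `5`, `6`. -/
def sweep : Prog := seqs [
  seqs [.setVar 7 (.const 0), .setVar 8 (.const 0), .setVar 9 (.const 0), .setVar 10 (.const 0)],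
  .loop (.ilt (.var 7) (.var 6)) sweepStep,
  seqs [.ite (.ieq (.var 10) (.const 1)) place .skip, .setVar 0 (.var 8)]]

/-- The slabs `S` are stored in the real arrays `4`, `5`, `6`, their number in register `6`. -/
structure Stores (S : Slabs) (s : State) : Prop where
  m : s.ivar 6 = S.m
  x : ∀ j ≤ S.m, s.rarr 4 j = S.x j
  l : ∀ j < S.m, s.rarr 5 j = S.l j
  u : ∀ j < S.m, s.rarr 6 j = S.u j

lemma Stores.of_frame {S : Slabs} {s s' : State} (h : Stores S s) (hf : Frame s s') :
    Stores S s' :=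
  ⟨hf.m.trans h.m, fun j hj => by rw [hf.x]; exact h.x j hj,
    fun j hj => by rw [hf.l]; exact h.l j hj, fun j hj => by rw [hf.u]; exact h.u j hj⟩

lemma den_sweepStep (s : State) : ∃ s', Frame s s' ∧ sweepOf s' = (sweepOf s).step
      (s.rarr 4 (s.ivar 7)) (s.rarr 5 (s.ivar 7)) (s.rarr 6 (s.ivar 7)) ∧
    sweepStep.den s = s'.setVar 7 (s.ivar 7 + 1) := by
  obtain ⟨e1, f1⟩ := den_commit s
  set s1 := commit.den s with h1
  obtain ⟨e2, f2⟩ := den_serve s1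
  set s2 := serve.den s1 with h2
  obtain ⟨e3, f3⟩ := den_view s2
  set s3 := view.den s2 with h3
  obtain ⟨e4, f4⟩ := den_start s3
  set s4 := start.den s3 with h4
  obtain ⟨e5, f5⟩ := den_addLow s4
  set s5 := addLow.den s4 with h5
  obtain ⟨e6, f6⟩ := den_addHigh s5
  set s6 := addHigh.den s5 with h6
  obtain ⟨e7, f7⟩ := den_narrow s6
  have g2 := f1.trans f2
  have g3 := g2.trans f3
  have g4 := g3.trans f4
  have g5 := g4.trans f5
  have g6 := g5.trans f6
  have g7 := g6.trans f7
  refine ⟨narrow.den s6, g7, ?_, ?_⟩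
  · rw [e7, e6, e5, e4, e3, e2, e1, g6.k, g5.k, g4.k, g3.k, g2.k, f1.k, g6.l, g6.u, g5.u, g4.l, g3.l,
      g3.u, g2.l, g2.u, f1.l, f1.u, Sweep.step]
  · rw [← g7.k]
    rfl

lemma sweepStep_loopFree : sweepStep.LoopFree := by
  simp [sweepStep, seqs, commit, serve, view, start, addLow, addHigh, narrow, place, inc, setMax,
    setMin, Prog.LoopFree]

/-- The sweep program computes an optimal guard set in linear time. -/
lemma reach_sweep {S : Slabs} (hS : S.Valid) {s : State} (hs : Stores S s) :
    ∃ s', Reach sweep s s' (70 * S.m + 20) ∧ IsMinimumGuardSet S.region (outputPoints s') ∧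
      outputCount s' = (outputPoints s').card := by
  set ini : Prog := seqs [.setVar 7 (.const 0), .setVar 8 (.const 0), .setVar 9 (.const 0),
    .setVar 10 (.const 0)] with hini
  set fin : Prog := seqs [.ite (.ieq (.var 10) (.const 1)) place .skip, .setVar 0 (.var 8)] with hfin
  have r1 : Reach ini s (ini.den s) ini.cost :=
    Prog.LoopFree.reach (by simp [hini, seqs, Prog.LoopFree]) s
  set s₁ := ini.den s with hs₁
  have hs1 : Stores S s₁ := by
    refine ⟨?_, hs.x, hs.l, hs.u⟩
    rw [← hs.m]
    simp [hs₁, hini, seqs, Prog.den, State.setVar]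
  set s₀ := sweepOf s₁ with hs₀
  obtain ⟨s₂, r2, hm, hk, hrun⟩ := reach_loop (c := .ilt (.var 7) (.var 6)) (p := sweepStep)
    sweepStep_loopFree (N := S.m)
    (I := fun k t => Stores S t ∧ t.ivar 7 = k ∧ sweepOf t = Sweep.run S s₀ k)
    (fun t ht => by
      simp only [Cond.Holds, IExpr.eval]
      rw [ht.1.m, ht.2.1]
      exact lt_irrefl _)
    (fun k hk t ht => by
      simp only [Cond.Holds, IExpr.eval]
      rw [ht.1.m, ht.2.1]
      exact hk)
    (fun k hk t ht => by
      obtain ⟨h1, h2, h3⟩ := ht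
      obtain ⟨t', hf, h4, h5⟩ := den_sweepStep t
      have h6 := h1.of_frame hf
      rw [h5]
      refine ⟨⟨?_, h6.x, h6.l, h6.u⟩, ?_, ?_⟩
      · rw [← h6.m]; simp [State.setVar]
      · simp [State.setVar, h2]
      · have : sweepOf (t'.setVar 7 (t.ivar 7 + 1)) = sweepOf t' := by
          simp [sweepOf, State.setVar]
        rw [this, h4, h3, h2, h1.x k hk.le, h1.l k hk, h1.u k hk]
        rfl)
    (s := s₁) ⟨hs1, rfl, rfl⟩
  have r3 : Reach fin s₂ (fin.den s₂) fin.cost :=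
    Prog.LoopFree.reach (by simp [hfin, seqs, place, inc, Prog.LoopFree]) s₂
  refine ⟨fin.den s₂, ?_, ?_⟩
  · obtain ⟨t, ht, hex⟩ := r1.seq (r2.seq r3)
    refine ⟨t, ht.trans ?_, hex⟩
    have c1 : ini.cost = 4 := rfl
    have c2 : fin.cost = 6 := rfl
    have c3 : sweepStep.cost ≤ 69 := by decide
    have := Nat.mul_le_mul_left S.m (Nat.succ_le_succ c3)
    rw [c1, c2]
    simp only [Nat.succ_eq_add_one] at this
    omega
  · have key : (fin.den s₂).ivar 0 = (S.sweepGuards s₀).c ∧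
        (fin.den s₂).rarr 2 = (S.sweepGuards s₀).X ∧ (fin.den s₂).rarr 3 = (S.sweepGuards s₀).Y := by
      rw [sweepGuards, ← hrun, ← hm.x S.m le_rfl, ← hk]
      have hfd : fin.den s₂ = (Prog.setVar 0 (.var 8)).den
          ((Prog.ite (.ieq (.var 10) (.const 1)) place .skip).den s₂) := rfl
      rw [hfd, Sweep.finish]
      by_cases h : s₂.ivar 10 = 1
      · rw [Prog.den_ite_pos (by exact h), if_pos (by exact h), ← (den_place s₂).1]
        exact ⟨rfl, rfl, rfl⟩
      · rw [Prog.den_ite_neg (by exact h), if_neg (by exact h)]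
        exact ⟨rfl, rfl, rfl⟩
    have hspec := sweepGuards_spec hS (s₀ := s₀) rfl rfl rfl
    rw [outputPoints, outputCount, key.1, key.2.1, key.2.2]
    exact hspec

/-! ### The programs that compute the slabs -/

/-- Append the next term of the periodic sequence to the arrays `0` and `1` of coordinates. -/
def copyStep : Prog := seqs [
  .rcopy 0 (.var 2) 0 (.var 1), .rcopy 1 (.var 2) 1 (.var 1), inc 1, inc 2]

/-- Append a whole period: register `1` runs up to the bound in register `3`. -/
def copyLoop : Prog := .loop (.ilt (.var 1) (.var 3)) copyStep

/-- Repeat the coordinates of the vertices so that they are stored three times; no index that occurs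
later has to be reduced modulo the number of vertices. -/
def unroll : Prog := seqs [
  seqs [.setVar 2 (.var 0), .setVar 3 (.var 0)],
  copyLoop,
  .setVar 3 (.var 2),
  copyLoop]

/-- The arrays `0` and `1` hold the coordinates of the first `N` terms of the sequence `w`. -/
structure Coords (w : ℕ → ℝ × ℝ) (N : ℕ) (s : State) : Prop where
  x : ∀ q < N, s.rarr 0 q = (w q).1
  y : ∀ q < N, s.rarr 1 q = (w q).2

lemma reach_copyLoop {n : ℕ} {w : ℕ → ℝ × ℝ} (hper : ∀ i, w (i + n) = w i) (hn : 0 < n) {i : ℕ}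
    {s : State}
    (hs : Coords w (n + i) s) (h0 : s.ivar 0 = n) (h1 : s.ivar 1 = i) (h2 : s.ivar 2 = n + i)
    (h3 : s.ivar 3 = n + i) :
    ∃ s', Reach copyLoop s s' (5 * n + 1) ∧ Coords w (n + i + n) s' ∧ s'.ivar 0 = n ∧
      s'.ivar 1 = n + i ∧ s'.ivar 2 = n + i + n := by
  obtain ⟨s', hr, hI⟩ := reach_loop (c := .ilt (.var 1) (.var 3)) (p := copyStep) (N := n)
    (by simp [copyStep, seqs, inc, Prog.LoopFree])
    (I := fun k t => Coords w (n + i + k) t ∧ t.ivar 0 = n ∧ t.ivar 1 = i + k ∧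
      t.ivar 2 = n + i + k ∧ t.ivar 3 = n + i)
    (fun t ht => by
      simp only [Cond.Holds, IExpr.eval]
      omega)
    (fun k hk t ht => by
      simp only [Cond.Holds, IExpr.eval]
      omega)
    (fun k hk t ht => by
      obtain ⟨g, g0, g1, g2, g3⟩ := ht
      refine ⟨⟨fun q hq => ?_, fun q hq => ?_⟩, ?_, ?_, ?_, ?_⟩
      · have hx := g.x (i + k) (by omega)
        rw [← hper, show i + k + n = n + i + k by omega] at hx
        simp only [copyStep, seqs, inc, Prog.den, IExpr.eval, State.setReal, State.setVar,
          Function.update_apply, g1, g2]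
        norm_num
        by_cases hq' : q = n + i + k
        · rw [hq', Function.update_self]; exact hx
        · rw [Function.update_of_ne hq']; exact g.x q (by omega)
      · have hy := g.y (i + k) (by omega)
        rw [← hper, show i + k + n = n + i + k by omega] at hy
        simp only [copyStep, seqs, inc, Prog.den, IExpr.eval, State.setReal, State.setVar,
          Function.update_apply, g1, g2]
        norm_num
        by_cases hq' : q = n + i + k
        · rw [hq', Function.update_self]; exact hy
        · rw [Function.update_of_ne hq']; exact g.y q (by omega)
      all_goals
        simp [copyStep, seqs, inc, Prog.den, IExpr.eval, State.setReal, State.setVar, g0, g1, g2, g3]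
        try omega)
    (s := s) ⟨hs, h0, by omega, by omega, h3⟩
  obtain ⟨g, g0, g1, g2, -⟩ := hI
  refine ⟨s', ?_, g, g0, by omega, g2⟩
  have c : copyStep.cost = 4 := rfl
  rw [c, Nat.mul_comm] at hr
  exact hr

lemma reach_unroll {n : ℕ} {w : ℕ → ℝ × ℝ} (hper : ∀ i, w (i + n) = w i) (hn : 0 < n) {s : State}
    (hs : Coords w n s) (h0 : s.ivar 0 = n) (h1 : s.ivar 1 = 0) :
    ∃ s', Reach unroll s s' (10 * n + 5) ∧ Coords w (3 * n) s' ∧ s'.ivar 0 = n := by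
  set ini : Prog := seqs [.setVar 2 (.var 0), .setVar 3 (.var 0)] with hini
  have r1 : Reach ini s (ini.den s) ini.cost :=
    Prog.LoopFree.reach (by simp [hini, seqs, Prog.LoopFree]) s
  obtain ⟨s₂, r2, g, g0, g1, g2⟩ := reach_copyLoop hper hn (i := 0) (s := ini.den s)
    ⟨hs.x, hs.y⟩ (by simp [hini, seqs, Prog.den, State.setVar, h0])
    (by simp [hini, seqs, Prog.den, State.setVar, h1])
    (by simp [hini, seqs, Prog.den, State.setVar, h0, IExpr.eval])
    (by simp [hini, seqs, Prog.den, State.setVar, h0, IExpr.eval])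
  have r3 : Reach (.setVar 3 (.var 2)) s₂ _ 1 :=
    Prog.LoopFree.reach (by simp [Prog.LoopFree]) s₂
  obtain ⟨s₄, r4, k, k0, k1, k2⟩ := reach_copyLoop hper hn (i := n)
    (s := (Prog.setVar 3 (.var 2)).den s₂)
    ⟨g.x, g.y⟩ (by simp [Prog.den, State.setVar, g0])
    (by simp [Prog.den, State.setVar, g1])
    (by simp [Prog.den, State.setVar, g2])
    (by simp [Prog.den, State.setVar, g2, IExpr.eval])
  obtain ⟨t, ht, hex⟩ := r1.seq (r2.seq (r3.seq r4))
  refine ⟨s₄, ⟨t, ht.trans ?_, hex⟩, ?_, k0⟩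
  · have c : ini.cost = 2 := rfl
    omega
  · rw [show 3 * n = n + n + n by omega]
    exact k

/-- After vertex `i` there is a left turn, where `i` is in register `1`. -/
def leftTurn : Cond :=
  .and (.rlt 0 (.succ (.var 1)) 0 (.var 1))
    (.and (.and (.not (.rlt 0 (.succ (.var 1)) 0 (.succ (.succ (.var 1)))))
        (.not (.rlt 0 (.succ (.succ (.var 1))) 0 (.succ (.var 1)))))
      (.rlt 0 (.succ (.succ (.var 1))) 0 (.succ (.succ (.succ (.var 1))))))

/-- Find the left turn, and put the index of the last vertex of the circuit that starts there into
register `2`. -/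
def search : Prog := seqs [
  seqs [.setVar 1 (.const 0), .setVar 2 (.succ (.var 0))],
  .loop (.not leftTurn) (seqs [inc 1, inc 2])]

lemma leftTurn_holds {w : ℕ → ℝ × ℝ} {N : ℕ} {s : State} (hs : Coords w N s)
    (hi : s.ivar 1 + 3 < N) : leftTurn.Holds s ↔ LeftTurn w (s.ivar 1) := by
  simp only [leftTurn, Cond.Holds, IExpr.eval, LeftTurn]
  rw [hs.x _ (by omega), hs.x _ (by omega), hs.x _ (by omega), hs.x _ (by omega)]
  refine and_congr_right' (and_congr_left' ?_)
  rw [not_lt, not_lt, and_comm]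
  exact le_antisymm_iff.symm

lemma reach_search {n : ℕ} {w : ℕ → ℝ × ℝ} (hn : 3 ≤ n) (hw : ∃ i < n, LeftTurn w i) {s : State}
    (hs : Coords w (3 * n) s) (h0 : s.ivar 0 = n) :
    ∃ s' i, Reach search s s' (3 * n + 3) ∧ Coords w (3 * n) s' ∧ LeftTurn w i ∧ i < n ∧
      s'.ivar 1 = i ∧ s'.ivar 2 = n + 1 + i := by
  classical
  have hex : ∃ i, LeftTurn w i := hw.imp fun _ h => h.2
  set N := Nat.find hex with hN
  have hNn : N < n := by
    obtain ⟨i, hi, h⟩ := hw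
    exact (Nat.find_min' hex h).trans_lt hi
  set ini : Prog := seqs [.setVar 1 (.const 0), .setVar 2 (.succ (.var 0))] with hini
  have r1 : Reach ini s (ini.den s) ini.cost :=
    Prog.LoopFree.reach (by simp [hini, seqs, Prog.LoopFree]) s
  obtain ⟨s', r2, hI⟩ := reach_loop (c := .not leftTurn) (p := seqs [inc 1, inc 2]) (N := N)
    (by simp [seqs, inc, Prog.LoopFree])
    (I := fun k t => Coords w (3 * n) t ∧ t.ivar 1 = k ∧ t.ivar 2 = n + 1 + k)
    (fun t ht => by
      rw [Cond.Holds, not_not, leftTurn_holds ht.1 (by omega), ht.2.1]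
      exact Nat.find_spec hex)
    (fun k hk t ht => by
      rw [Cond.Holds, leftTurn_holds ht.1 (by omega), ht.2.1]
      exact Nat.find_min hex hk)
    (fun k hk t ht => by
      refine ⟨⟨ht.1.x, ht.1.y⟩, ?_, ?_⟩
      · simp [seqs, inc, Prog.den, IExpr.eval, State.setVar, ht.2.1]
      · simp [seqs, inc, Prog.den, IExpr.eval, State.setVar, ht.2.2, Nat.add_assoc])
    (s := ini.den s) ⟨⟨hs.x, hs.y⟩, by simp [hini, seqs, Prog.den, State.setVar, IExpr.eval],
      by simp [hini, seqs, Prog.den, State.setVar, IExpr.eval, h0]⟩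
  obtain ⟨t, ht, hexec⟩ := r1.seq r2
  refine ⟨s', N, ⟨t, ht.trans ?_, hexec⟩, hI.1, Nat.find_spec hex, hNn, hI.2.1, hI.2.2⟩
  have c1 : ini.cost = 2 := rfl
  have c2 : (seqs [inc 1, inc 2]).cost = 2 := rfl
  rw [c1, c2]
  omega

/-- Store the lower and the upper end of the slab between the edges in registers `4` and `5`. -/
def storeSlab : Prog :=
  .ite (.rlt 1 (.var 5) 1 (.var 4))
    (seqs [.rcopy 5 (.var 6) 1 (.var 5), .rcopy 6 (.var 6) 1 (.var 4)])
    (seqs [.rcopy 5 (.var 6) 1 (.var 4), .rcopy 6 (.var 6) 1 (.var 5)])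

/-- Store the next breakpoint and advance on the chains whose edge ends there. -/
def advance : Prog :=
  .ite (.rlt 0 (.succ (.var 4)) 0 (.pred (.var 5)))
    (seqs [.rcopy 4 (.succ (.var 6)) 0 (.succ (.var 4)), .setVar 4 (.succ (.succ (.var 4)))])
    (.ite (.rlt 0 (.pred (.var 5)) 0 (.succ (.var 4)))
      (seqs [.rcopy 4 (.succ (.var 6)) 0 (.pred (.var 5)), .setVar 5 (.pred (.pred (.var 5)))])
      (seqs [.rcopy 4 (.succ (.var 6)) 0 (.succ (.var 4)), .setVar 4 (.succ (.succ (.var 4))),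
        .setVar 5 (.pred (.pred (.var 5)))]))

/-- Compute the slabs by walking along both chains from the left turn. -/
def merge : Prog := seqs [
  seqs [.setVar 4 (.succ (.succ (.var 1))), .setVar 5 (.var 2), .setVar 6 (.const 0),
    .rcopy 4 (.const 0) 0 (.var 4)],
  .loop (.ilt (.var 4) (.var 5)) (seqs [storeSlab, advance, inc 6])]

lemma den_storeSlab (s : State) : storeSlab.den s =
    (s.setReal 5 (s.ivar 6) (min (s.rarr 1 (s.ivar 4)) (s.rarr 1 (s.ivar 5)))).setReal 6 (s.ivar 6)
      (max (s.rarr 1 (s.ivar 4)) (s.rarr 1 (s.ivar 5))) := by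
  by_cases h : s.rarr 1 (s.ivar 5) < s.rarr 1 (s.ivar 4)
  · rw [storeSlab, Prog.den_ite_pos (by exact h), min_eq_right h.le, max_eq_left h.le]
    rfl
  · rw [storeSlab, Prog.den_ite_neg (by exact h), min_eq_left (not_lt.1 h),
      max_eq_right (not_lt.1 h)]
    rfl

open Classical in
lemma den_advance (s : State) : advance.den s =
    ((s.setReal 4 (s.ivar 6 + 1) (min (s.rarr 0 (s.ivar 4 + 1)) (s.rarr 0 (s.ivar 5 - 1)))).setVar 4
      (if s.rarr 0 (s.ivar 5 - 1) < s.rarr 0 (s.ivar 4 + 1) then s.ivar 4 else s.ivar 4 + 2)).setVar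
      5 (if s.rarr 0 (s.ivar 4 + 1) < s.rarr 0 (s.ivar 5 - 1) then s.ivar 5 else s.ivar 5 - 2) := by
  by_cases h : s.rarr 0 (s.ivar 4 + 1) < s.rarr 0 (s.ivar 5 - 1)
  · rw [advance, Prog.den_ite_pos (by exact h), min_eq_left h.le, if_neg h.not_gt, if_pos h]
    simp [seqs, Prog.den, State.setReal, State.setVar, IExpr.eval]
  · rw [advance, Prog.den_ite_neg (by exact h), if_neg h]
    by_cases h' : s.rarr 0 (s.ivar 5 - 1) < s.rarr 0 (s.ivar 4 + 1)
    · rw [Prog.den_ite_pos (by exact h'), min_eq_right h'.le, if_pos h']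
      simp [seqs, Prog.den, State.setReal, State.setVar, IExpr.eval]
      rfl
    · rw [Prog.den_ite_neg (by exact h'), min_eq_left (not_lt.1 h'), if_neg h']
      rfl

/-- Merging takes linear time and stores the slabs between the two chains. Register `4` holds the left
end of the current edge of the chain that is traversed forwards, and register `5` that of the chain
that is traversed backwards; the two cross when the right end is reached. -/
lemma reach_merge {h A i : ℕ} {w : ℕ → ℝ × ℝ} (hstd : StdCircuit h A (fun j => w (i + 2 + j)))
    (hi : i < 2 * h) {s : State} (hs : Coords w (3 * (2 * h)) s) (h1 : s.ivar 1 = i)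
    (h2 : s.ivar 2 = 2 * h + 1 + i) :
    ∃ s' a b x m, Reach merge s s' (16 * h + 5) ∧ m ≤ h ∧
      IsMerge A (h - A) (StdCircuit.fx fun j => w (i + 2 + j))
        (StdCircuit.gx h fun j => w (i + 2 + j)) a b x m ∧
      Stores (mergeSlabs (StdCircuit.fy fun j => w (i + 2 + j))
        (StdCircuit.gy h fun j => w (i + 2 + j)) a b x m) s' := by
  have hpos := hstd.pos
  have hlt := hstd.lt
  set v : ℕ → ℝ × ℝ := fun j => w (i + 2 + j) with hv
  obtain ⟨m, hm, hmerge⟩ := hstd.chainPair.exists_isMerge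
  set p := StdCircuit.fx v with hp
  set q := StdCircuit.gx h v with hq
  set a : ℕ → ℕ := fun k => (mergeIdx p q k).1 with ha
  set b : ℕ → ℕ := fun k => (mergeIdx p q k).2 with hb
  set S := mergeSlabs (StdCircuit.fy v) (StdCircuit.gy h v) a b (mergeX p q) m with hSdef
  set ini : Prog := seqs [.setVar 4 (.succ (.succ (.var 1))), .setVar 5 (.var 2),
    .setVar 6 (.const 0), .rcopy 4 (.const 0) 0 (.var 4)] with hini
  have r1 : Reach ini s (ini.den s) ini.cost :=
    Prog.LoopFree.reach (by simp [hini, seqs, Prog.LoopFree]) s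
  obtain ⟨s', r2, hI⟩ := reach_loop (c := .ilt (.var 4) (.var 5))
    (p := seqs [storeSlab, advance, inc 6]) (N := m)
    (by simp [seqs, storeSlab, advance, inc, Prog.LoopFree])
    (I := fun k t => Coords w (3 * (2 * h)) t ∧ t.ivar 4 = i + 2 + 2 * a k ∧
      t.ivar 5 + 2 * b k = i + 2 + (2 * h - 1) ∧ t.ivar 6 = k ∧
      (∀ j ≤ k, t.rarr 4 j = S.x j) ∧ (∀ j < k, t.rarr 5 j = S.l j) ∧ ∀ j < k, t.rarr 6 j = S.u j)
    (fun t ht => by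
      obtain ⟨-, g4, g5, -⟩ := ht
      rw [hmerge.a_end] at g4
      rw [hmerge.b_end] at g5
      simp only [Cond.Holds, IExpr.eval]
      omega)
    (fun k hk t ht => by
      obtain ⟨-, g4, g5, -⟩ := ht
      have := hmerge.lt k hk
      simp only [Cond.Holds, IExpr.eval]
      omega)
    (fun k hk t ht => by
      obtain ⟨g, g4, g5, g6, gx, gl, gu⟩ := ht
      have hab := hmerge.lt k hk
      have yf : t.rarr 1 (t.ivar 4) = StdCircuit.fy v (a k) := by
        rw [g4, g.y _ (by omega)]; rfl
      have yg : t.rarr 1 (t.ivar 5) = StdCircuit.gy h v (b k) := by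
        rw [show t.ivar 5 = i + 2 + (2 * h - 1 - 2 * b k) by omega, g.y _ (by omega)]; rfl
      have xf : t.rarr 0 (t.ivar 4 + 1) = p (a k + 1) := by
        rw [g4, g.x _ (by omega)]; exact hstd.ver (a k)
      have xg : t.rarr 0 (t.ivar 5 - 1) = q (b k + 1) := by
        have e : t.ivar 5 - 1 = i + 2 + 2 * (h - 1 - b k) := by omega
        rw [hq, hstd.gx_succ hab.2, e, g.x _ (by omega)]
      have hden : (seqs [storeSlab, advance, inc 6]).den t =
          (inc 6).den (advance.den (storeSlab.den t)) := rfl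
      rw [hden, den_advance, den_storeSlab]
      refine ⟨⟨g.x, g.y⟩, ?_, ?_, ?_, fun j hj => ?_, fun j hj => ?_, fun j hj => ?_⟩
      · change (if t.rarr 0 (t.ivar 5 - 1) < t.rarr 0 (t.ivar 4 + 1) then t.ivar 4
          else t.ivar 4 + 2) = _
        rw [xf, xg]
        simp only [ha, hb, mergeIdx]
        split_ifs
        · exact g4
        · rw [g4]; ring
      · change (if t.rarr 0 (t.ivar 4 + 1) < t.rarr 0 (t.ivar 5 - 1) then t.ivar 5
          else t.ivar 5 - 2) + _ = _
        rw [xf, xg]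
        simp only [ha, hb, mergeIdx]
        split_ifs
        · exact g5
        · have e : b k = (mergeIdx p q k).2 := rfl
          omega
      · change t.ivar 6 + 1 = k + 1
        rw [g6]
      · change Function.update (t.rarr 4) (t.ivar 6 + 1)
          (min (t.rarr 0 (t.ivar 4 + 1)) (t.rarr 0 (t.ivar 5 - 1))) j = S.x j
        rw [xf, xg, g6]
        rcases Nat.le_succ_iff.1 hj with hj' | rfl
        · rw [Function.update_of_ne (by omega), gx j hj']
        · rw [Function.update_self]; rfl
      · change Function.update (t.rarr 5) (t.ivar 6)
          (min (t.rarr 1 (t.ivar 4)) (t.rarr 1 (t.ivar 5))) j = S.l j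
        rw [yf, yg, g6]
        rcases Nat.lt_succ_iff_lt_or_eq.1 hj with hj' | rfl
        · rw [Function.update_of_ne (by omega), gl j hj']
        · rw [Function.update_self]; rfl
      · change Function.update (t.rarr 6) (t.ivar 6)
          (max (t.rarr 1 (t.ivar 4)) (t.rarr 1 (t.ivar 5))) j = S.u j
        rw [yf, yg, g6]
        rcases Nat.lt_succ_iff_lt_or_eq.1 hj with hj' | rfl
        · rw [Function.update_of_ne (by omega), gu j hj']
        · rw [Function.update_self]; rfl)
    (s := ini.den s) (by
      refine ⟨⟨hs.x, hs.y⟩, ?_, ?_, rfl, fun j hj => ?_, fun j hj => absurd hj (Nat.not_lt_zero _),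
        fun j hj => absurd hj (Nat.not_lt_zero _)⟩
      · change s.ivar 1 + 1 + 1 = i + 2 + 2 * 0
        omega
      · change s.ivar 2 + 2 * 0 = _
        omega
      · obtain rfl : j = 0 := by omega
        change s.rarr 0 (s.ivar 1 + 1 + 1) = (w (i + 2 + 2 * 0)).1
        rw [h1, hs.x _ (by omega)])
  obtain ⟨t, ht, hexec⟩ := r1.seq r2
  refine ⟨s', a, b, mergeX p q, m, ⟨t, ht.trans ?_, hexec⟩, by omega, hmerge, ?_⟩
  · have c1 : ini.cost = 4 := rfl
    have c2 : (seqs [storeSlab, advance, inc 6]).cost = 15 := rfl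
    rw [c1, c2]
    omega
  · exact ⟨hI.2.2.2.1, hI.2.2.2.2.1, hI.2.2.2.2.2.1, hI.2.2.2.2.2.2⟩

/-- The program that computes an optimal guard set of a polygon. -/
def guards : Prog := seqs [unroll, search, merge, sweep]

end Algo

end ArtGallery

theorem mainTheorem1 :
    ∃ (A : GeomRAM.Prog) (C : ℕ),
      ∀ (n : ℕ) (P : Polygon (ℝ × ℝ) n),
        ArtGallery.IsSimple P → ArtGallery.IsOrthogonal P → ArtGallery.IsXMonotone P →
        ∃ (s : GeomRAM.State) (t : ℕ),
          GeomRAM.Exec A (GeomRAM.input P) s t ∧ t ≤ C * n ∧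
          ArtGallery.IsMinimumGuardSet (ArtGallery.region P) (GeomRAM.outputPoints s) ∧
          GeomRAM.outputCount s = (GeomRAM.outputPoints s).card := by
  refine ⟨ArtGallery.Algo.guards, 100, fun n P h1 h2 h3 => ?_⟩
  have hn : 3 ≤ n := h1.1
  have hn0 : 0 < n := by omega
  have hw := ArtGallery.circuit_vert hn0 h1 h2 h3
  set w := ArtGallery.vert hn0 P with hwdef
  have hin : ArtGallery.Algo.Coords w n (GeomRAM.input P) := by
    constructor <;> intro q hq <;>
    simp [GeomRAM.input, hq, hwdef, ArtGallery.vert, Nat.mod_eq_of_lt hq]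
  obtain ⟨s₁, r1, g1, g10⟩ := ArtGallery.Algo.reach_unroll hw.per hn0 hin (by simp [GeomRAM.input])
    (by simp [GeomRAM.input])
  obtain ⟨s₂, i, r2, g2, hturn, hi, g21, g22⟩ :=
    ArtGallery.Algo.reach_search hn hw.exists_leftTurn g1 g10
  obtain ⟨h, A, hnh, hstd⟩ := hw.std_of_leftTurn hturn
  obtain ⟨s₃, a, b, x, m, r3, hm, hmerge, g3⟩ := ArtGallery.Algo.reach_merge hstd (by omega)
    (by rw [← hnh]; exact g2) g21 (by rw [← hnh]; exact g22)
  obtain ⟨s₄, r4, hmin, hcard⟩ := ArtGallery.Algo.reach_sweep (hmerge.valid hstd.chainPair) g3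
  obtain ⟨t, ht, hexec⟩ := r1.seq (r2.seq (r3.seq r4))
  refine ⟨s₄, t, hexec, ht.trans ?_, ?_, hcard⟩
  · change 10 * n + 5 + (3 * n + 3 + (16 * h + 5 + (70 * m + 20))) ≤ 100 * n
    omega
  · rw [ArtGallery.region_eq_slabs hn0 hnh hstd hmerge]
    exact hmin
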